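/- **Conventions.** Let $\kappa$ be an uncountable regular cardinal, let $H(\kappa)$ be the family of all sets whose transitive closure has size $<\kappa$, and let $\prec^*$ be a well-ordering of $H(\kappa)$. Let $\theta$ be the truth predicate of $(H(\kappa);\in,\prec^*)$, i.e. for every formula $\varphi$ of the language $\{\in,\prec^*\}$ with $n$ free variables and all $x_1,\dots,x_n\in H(\kappa)$, $\theta(\varphi,x_1,\dots,x_n)$ holds iff $(H(\kappa);\in,\prec^*)\models\varphi(x_1,\dots,x_n)$. (Formulas are coded by natural numbers and tuples by finite sequences.) "Definable" always means definable with parameters. Limit ordinals are nonzero; an ordinal is even if it is of the form $\lambda+2n$ with $n<\omega$ and $\lambda$ zero or a limit, and odd otherwise. An *invariant* is a triple $(A,B,E)$ with $A,B\in H(\mathfrak c^+)$ and $E\subseteq A\times B$ such that for every $a\in A$ there is $b\in B$ with $a\,E\,b$, and for every $b\in B$ there is $a\in A$ with not $a\,E\,b$. It is *definable over* $(H(\kappa);\in)$ if $A$, $B$, $E$ are definable subsets of that structure. For $A'\subseteq A$ write $A'\,E\,b$ if $a\,E\,b$ for all $a\in A'$. This gives the triple $([A]^{\le\omega},B,E)$,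 where $[A]^{\le\omega}$ is the set of countable subsets of $A$. * $\Phi([A]^{\le\omega},B,E)$ *restricted to a class of functions*: for every $F:2^{<\omega_1}\to[A]^{\le\omega}$ in the class there is $g:\omega_1\to B$ such that for every $f\in 2^{\omega_1}$ the set $\{\alpha<\omega_1 : F(f\restriction\alpha)\,E\,g(\alpha)\}$ is stationary. * For sequences $\mathcal H=\langle h_\alpha:\alpha<\omega_1\rangle$ in $H(\kappa)$ and $\mathcal B=\langle b_\alpha:\alpha<\omega_1\rangle$ in $B$, the *game* $\mathcal G_{(A,B,E)}(\mathcal H,\mathcal B)$ on $H(\kappa)$ has length $\omega_1$. At each even step $\alpha$, BAD plays $\ast_\alpha\in H(\omega_1)$, where for limit $\alpha$ BAD must play $\ast_\alpha=\{\ast_\beta:\beta<\alpha,\ \beta\text{ even}\}$. At the odd step $\alpha+1$, GOOD plays a countable elementary submodel $M_{\alpha+1}\prec(H(\kappa);\in,\prec^*)$ with $\{\ast_\alpha,h_\alpha,\{M_\beta:\beta<\alpha,\ \beta\text{ odd}\}\}\in M_{\alpha+1}$. GOOD wins if $\{\alpha<\omega_1 : \alpha\text{ even},\ A\cap M_{\alpha+1}\,E\,b_\alpha\}$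 is stationary. * $\diamondsuit_{\mathrm{STR}}((A,B,E),H(\kappa))$: for every $\mathcal H$ there is $\mathcal B$ such that GOOD has a winning strategy in $\mathcal G_{(A,B,E)}(\mathcal H,\mathcal B)$ on $H(\kappa)$. * $\diamondsuit_{\mathrm{EL}}((A,B,E),H(\kappa))$: for every $\mathcal H$ there is $\mathcal B$ such that for every continuous sequence $\langle\ast_\alpha:\alpha<\omega_1\rangle$ in $H(\omega_1)$ (i.e. $\ast_\alpha=\{\ast_\beta:\beta<\alpha\}$ for every limit $\alpha<\omega_1$) there is an increasing chain $\langle M_\alpha:\alpha<\omega_1\rangle$ of countable elementary submodels of $(H(\kappa);\in,\prec^*)$ such that $\{\ast_\alpha,h_\alpha,\{M_\beta:\beta<\alpha\}\}\in M_{\alpha+1}$ for all $\alpha<\omega_1$ and $\{\alpha<\omega_1 : A\cap M_{\alpha+1}\,E\,b_\alpha\}$ is stationary. *Restricted to $\ast_\alpha=X\cap\alpha$* means that the same is required for the sequences $\langle X\cap\alpha:\alpha<\omega_1\rangle$ with $X\subseteq\omega_1$ instead of the continuous sequences. **Theorem.** For every invariant $(A,B,E)$ definable over $(H(\kappa);\in)$,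 each of the following conditions implies the next. 1. $\Phi([A]^{\le\omega},B,E)$ restricted to functions $F$ such that $F\restriction 2^\alpha$ is definable over $(H(\kappa);\in,\prec^*,\theta)$ for each $\alpha<\omega_1$. 2. $\diamondsuit_{\mathrm{STR}}((A,B,E),H(\kappa))$. 3. $\diamondsuit_{\mathrm{EL}}((A,B,E),H(\kappa))$ restricted to the case where $\ast_\alpha=X\cap\alpha$ for some $X\subseteq\omega_1$. 4. $\diamondsuit_{\mathrm{EL}}((A,B,E),H(\kappa))$. 5. $\Phi([A]^{\le\omega},B,E)$ restricted to functions $F$ such that $F\restriction 2^\alpha$ is definable over $(H(\kappa);\in,\prec^*)$ for each $\alpha<\omega_1$. -/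

import Mathlib

open Cardinal Set
open scoped Ordinal

universe u

namespace GuessingModels

/-! ### Sets of hereditary cardinality `< κ` -/

/-- The (members of the) transitive closure of a set. -/
def transClosure (x : ZFSet.{u}) : Set ZFSet.{u} :=
  {y | Relation.TransGen (fun a b : ZFSet.{u} => a ∈ b) y x}

/-- `H κ`: all sets whose transitive closure has size `< κ`. -/
def H (κ : Cardinal.{u}) : Set ZFSet.{u} :=
  {x | Cardinal.mk (transClosure x) < Cardinal.lift.{u + 1} κ}

/-! ### Languages and structures on `H κ` -/

/-- The relation symbols of the language `{∈}`. -/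
inductive SetRel : ℕ → Type
  | mem : SetRel 2

/-- The relation symbols of the language `{∈, ≺*}`. -/
inductive OrdRel : ℕ → Type
  | mem : OrdRel 2
  | prec : OrdRel 2

/-- The relation symbols of the language `{∈, ≺*, θ}`. -/
inductive TruthRel : ℕ → Type
  | mem : TruthRel 2
  | prec : TruthRel 2
  | truth : TruthRel 2

/-- The language `{∈}`. -/
def setLang : FirstOrder.Language.{0, 0} := ⟨fun _ => Empty, SetRel⟩

/-- The language `{∈, ≺*}`. -/
def ordLang : FirstOrder.Language.{0, 0} := ⟨fun _ => Empty, OrdRel⟩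

/-- The language `{∈, ≺*, θ}`. -/
def truthLang : FirstOrder.Language.{0, 0} := ⟨fun _ => Empty, TruthRel⟩

/-- The structure `(H κ; ∈)`. -/
@[reducible] def setStr (κ : Cardinal.{u}) : setLang.Structure (H κ) where
  funMap := fun f => nomatch f
  RelMap := fun R x => match R with
    | .mem => (x 0).1 ∈ (x 1).1

/-- The structure `(H κ; ∈, ≺*)`. -/
@[reducible] def ordStr {κ : Cardinal.{u}} (prec : H κ → H κ → Prop) :
    ordLang.Structure (H κ) where
  funMap := fun f => nomatch f
  RelMap := fun R x => match R with
    | .mem => (x 0).1 ∈ (x 1).1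
    | .prec => prec (x 0) (x 1)

/-! ### The truth predicate -/

/-- A numbering of the relation symbols. -/
instance : Encodable (Σ n, ordLang.Relations n) where
  encode R := match R with
    | ⟨_, .mem⟩ => 0
    | ⟨_, .prec⟩ => 1
  decode k := match k with
    | 0 => some ⟨2, OrdRel.mem⟩
    | 1 => some ⟨2, OrdRel.prec⟩
    | _ => none
  encodek R := match R with
    | ⟨_, .mem⟩ => rfl
    | ⟨_, .prec⟩ => rfl

instance (n : ℕ) : IsEmpty (ordLang.Functions n) := inferInstanceAs (IsEmpty Empty)

/-- The natural number `n` as a (von Neumann) set. -/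
noncomputable def natSet (n : ℕ) : ZFSet.{u} := (n : Ordinal.{u}).toZFSet

/-- The Gödel number of a formula of the language `{∈, ≺*}` with free variables among
`x₀, …, xₙ₋₁`. -/
def godelNumber {n : ℕ} (φ : ordLang.Formula (Fin n)) : ℕ :=
  Encodable.encode
    (FirstOrder.Language.BoundedFormula.encoding.encode
      (⟨0, φ⟩ : Σ k, ordLang.BoundedFormula (Fin n) k))

/-- The finite sequence `⟨x₀, …, xₙ₋₁⟩` as a set, namely as a function with domain `n`. -/
noncomputable def tuple {n : ℕ} (x : Fin n → ZFSet.{u}) : ZFSet.{u} :=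
  ZFSet.range fun i : Fin n => ZFSet.pair (natSet i) (x i)

/-- The truth predicate `θ` of `(H κ; ∈, ≺*)`: `θ` holds of the code of a formula `φ` and of a
finite sequence `x` if and only if `(H κ; ∈, ≺*) ⊨ φ(x)` (see `truth_iff`). -/
def truth {κ : Cardinal.{u}} (prec : H κ → H κ → Prop) (c t : H κ) : Prop :=
  letI := ordStr prec
  ∃ (n : ℕ) (φ : ordLang.Formula (Fin n)) (x : Fin n → H κ),
    c.1 = natSet (godelNumber φ) ∧ t.1 = tuple (fun i => (x i).1) ∧ φ.Realize x

/-- The structure `(H κ; ∈, ≺*, θ)`. -/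
@[reducible] def truthStr {κ : Cardinal.{u}} (prec : H κ → H κ → Prop) :
    truthLang.Structure (H κ) where
  funMap := fun f => nomatch f
  RelMap := fun R x => match R with
    | .mem => (x 0).1 ∈ (x 1).1
    | .prec => prec (x 0) (x 1)
    | .truth => truth prec (x 0) (x 1)

theorem natSet_injective : Function.Injective natSet.{u} := by
  intro m n h
  exact_mod_cast Ordinal.toZFSet_injective h

theorem godelNumber_injective {n : ℕ} :
    Function.Injective (godelNumber : ordLang.Formula (Fin n) → ℕ) := by
  intro φ ψ h
  have h1 := FirstOrder.Language.BoundedFormula.encoding.encode_injective (Encodable.encode_injective h)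
  simpa using h1

theorem tuple_eq {m n : ℕ} {x : Fin m → ZFSet.{u}} {y : Fin n → ZFSet.{u}}
    (h : tuple x = tuple y) : ∃ e : m = n, ∀ i, x i = y (Fin.cast e i) := by
  have key : ∀ {m n : ℕ} {x : Fin m → ZFSet.{u}} {y : Fin n → ZFSet.{u}},
      tuple x = tuple y → ∀ i : Fin m, ∃ j : Fin n, (i : ℕ) = j ∧ x i = y j := by
    intro m n x y h i
    have hi : ZFSet.pair (natSet i) (x i) ∈ tuple y := by
      rw [← h]; exact ZFSet.mem_range.2 ⟨i, rfl⟩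
    obtain ⟨j, hj⟩ := ZFSet.mem_range.1 hi
    obtain ⟨h1, h2⟩ := ZFSet.pair_inj.1 hj
    exact ⟨j, (natSet_injective h1).symm, h2.symm⟩
  have le : ∀ {m n : ℕ} {x : Fin m → ZFSet.{u}} {y : Fin n → ZFSet.{u}},
      tuple x = tuple y → m ≤ n := by
    intro m n x y h
    by_contra hlt
    obtain ⟨j, hj, -⟩ := key h ⟨n, by omega⟩
    have := j.2
    simp only at hj
    omega
  have e : m = n := le_antisymm (le h) (le h.symm)
  refine ⟨e, fun i => ?_⟩
  obtain ⟨j, hj, hx⟩ := key h i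
  rw [hx]
  congr 1
  exact Fin.ext hj.symm

theorem truth_iff {κ : Cardinal.{u}} (prec : H κ → H κ → Prop) {n : ℕ}
    (φ : ordLang.Formula (Fin n)) (x : Fin n → H κ) (c t : H κ)
    (hc : c.1 = natSet (godelNumber φ)) (ht : t.1 = tuple (fun i => (x i).1)) :
    letI := ordStr prec
    truth prec c t ↔ φ.Realize x := by
  constructor
  · rintro ⟨m, ψ, y, hc', ht', hψ⟩
    obtain ⟨e, hxy⟩ := tuple_eq (ht.symm.trans ht')
    subst e
    obtain rfl := godelNumber_injective (natSet_injective (hc.symm.trans hc'))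
    have : x = y := funext fun i => Subtype.ext (by simpa using hxy i)
    rwa [this]
  · intro h
    exact ⟨n, φ, x, hc, ht, h⟩

/-! ### Definability (with parameters) and elementary submodels -/

/-- `D` is a definable subset of `(H κ; ∈)`. -/
def DefinableSubset (κ : Cardinal.{u}) (D : ZFSet.{u}) : Prop :=
  letI := setStr κ
  (∀ x ∈ D, x ∈ H κ) ∧ (univ : Set (H κ)).Definable₁ setLang {x : H κ | x.1 ∈ D}

/-- The restriction of `F` to `D`, as a binary relation on `H κ`. -/
def graphOn (κ : Cardinal.{u}) (F : ZFSet.{u} → ZFSet.{u}) (D : ZFSet.{u}) : Set (H κ × H κ) :=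
  {p | p.1.1 ∈ D ∧ p.2.1 = F p.1.1}

/-- `F ↾ D` is definable over `(H κ; ∈, ≺*)`. -/
def DefinableOrd {κ : Cardinal.{u}} (prec : H κ → H κ → Prop)
    (F : ZFSet.{u} → ZFSet.{u}) (D : ZFSet.{u}) : Prop :=
  letI := ordStr prec
  (univ : Set (H κ)).Definable₂ ordLang (graphOn κ F D)

/-- `F ↾ D` is definable over `(H κ; ∈, ≺*, θ)`. -/
def DefinableTruth {κ : Cardinal.{u}} (prec : H κ → H κ → Prop)
    (F : ZFSet.{u} → ZFSet.{u}) (D : ZFSet.{u}) : Prop :=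
  letI := truthStr prec
  (univ : Set (H κ)).Definable₂ truthLang (graphOn κ F D)

/-- `M` is a countable elementary submodel of `(H κ; ∈, ≺*)`. -/
def IsCountableElementary {κ : Cardinal.{u}} (prec : H κ → H κ → Prop) (M : ZFSet.{u}) : Prop :=
  letI := ordStr prec
  (M : Set ZFSet.{u}).Countable ∧
    ∃ S : ordLang.ElementarySubstructure (H κ), Subtype.val '' (S : Set (H κ)) = (M : Set ZFSet.{u})

/-! ### Ordinals below `ω₁` -/

/-- `S ∩ ω₁` is a stationary subset of `ω₁`. -/
def IsStationary (S : Set Ordinal.{u}) : Prop :=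
  ∀ C : Set (Iio (ω_ 1 : Ordinal.{u})), IsClub C → ∃ α ∈ C, α.1 ∈ S

/-- Even ordinals: `0`, `2`, …, and `λ`, `λ + 2`, … for limit `λ`. -/
def IsEven (α : Ordinal.{u}) : Prop := ∃ β, α = 2 * β

/-- Odd ordinals. -/
def IsOdd (α : Ordinal.{u}) : Prop := ∃ β, α = 2 * β + 1

/-- The set `{f β | β < α, P β}`. -/
noncomputable def below (f : Ordinal.{u} → ZFSet.{u}) (P : Ordinal.{u} → Prop)
    (α : Ordinal.{u}) : ZFSet.{u} :=
  ZFSet.range fun β : {β : Iio α // P β.1} => f β.1.1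

theorem mem_below {f : Ordinal.{u} → ZFSet.{u}} {P : Ordinal.{u} → Prop} {α : Ordinal.{u}}
    {x : ZFSet.{u}} : x ∈ below f P α ↔ ∃ β < α, P β ∧ f β = x := by
  simp only [below, ZFSet.mem_range, Subtype.exists, mem_Iio, exists_prop]

/-- `2 ^ α`: the set of functions from `α` to `2`. -/
noncomputable def binSeq (α : Ordinal.{u}) : ZFSet.{u} :=
  ZFSet.funs α.toZFSet (natSet 2)

/-- The restriction `f ↾ α` of a set-theoretic function. -/
noncomputable def restrict (f : ZFSet.{u}) (α : Ordinal.{u}) : ZFSet.{u} :=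
  f.sep fun p => ∃ x ∈ α.toZFSet, ∃ y, p = ZFSet.pair x y

/-! ### Invariants and the principles -/

/-- A triple `(A, B, E)`. -/
structure Triple where
  A : ZFSet.{u}
  B : ZFSet.{u}
  E : ZFSet.{u}

namespace Triple

variable (T : Triple.{u})

/-- `a E b`. -/
def Rel (a b : ZFSet.{u}) : Prop := ZFSet.pair a b ∈ T.E

/-- `(A, B, E)` is an invariant. -/
structure IsInvariant : Prop where
  memA : T.A ∈ H (Order.succ continuum.{u})
  memB : T.B ∈ H (Order.succ continuum.{u})
  sub : T.E ⊆ ZFSet.prod T.A T.B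
  exists_rel : ∀ a ∈ T.A, ∃ b ∈ T.B, T.Rel a b
  exists_not_rel : ∀ b ∈ T.B, ∃ a ∈ T.A, ¬ T.Rel a b

/-- `A`, `B`, `E` are definable subsets of `(H κ; ∈)`. -/
def IsDefinable (κ : Cardinal.{u}) : Prop :=
  DefinableSubset κ T.A ∧ DefinableSubset κ T.B ∧ DefinableSubset κ T.E

/-- The triple `([A]^{≤ ω}, B, E)`, where `a E b` means `x E b` for all `x ∈ a`. -/
noncomputable def countableSubsets : Triple.{u} where
  A := T.A.powerset.sep fun a => (a : Set ZFSet.{u}).Countable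
  B := T.B
  E := (ZFSet.prod (T.A.powerset.sep fun a => (a : Set ZFSet.{u}).Countable) T.B).sep
    fun p => ∃ a b, p = ZFSet.pair a b ∧ ∀ x ∈ a, T.Rel x b

/-- `Φ(A, B, E)` restricted to those `F : 2^{< ω₁} → A` for which each `F ↾ 2 ^ α`, `α < ω₁`,
satisfies `Def`. -/
def Phi (Def : (ZFSet.{u} → ZFSet.{u}) → ZFSet.{u} → Prop) : Prop :=
  ∀ F : ZFSet.{u} → ZFSet.{u},
    (∀ α < (ω_ 1 : Ordinal.{u}), ∀ s ∈ binSeq α, F s ∈ T.A) →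
    (∀ α < (ω_ 1 : Ordinal.{u}), Def F (binSeq α)) →
    ∃ g : Ordinal.{u} → ZFSet.{u}, (∀ α < (ω_ 1 : Ordinal.{u}), g α ∈ T.B) ∧
      ∀ f ∈ binSeq (ω_ 1 : Ordinal.{u}), IsStationary {α | T.Rel (F (restrict f α)) (g α)}

/-- `A ∩ M E b`. -/
def Guesses (M b : ZFSet.{u}) : Prop := ∀ a ∈ T.A, a ∈ M → T.Rel a b

end Triple

/-- A run of moves of BAD (only the values at even ordinals `< ω₁` matter) that obeys the rules
of the game: each move belongs to `H ω₁`, and at limit steps the move is the set of all the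
previous moves. -/
def IsBadRun (s : Ordinal.{u} → ZFSet.{u}) : Prop :=
  (∀ α < (ω_ 1 : Ordinal.{u}), IsEven α → s α ∈ H ℵ₁) ∧
    ∀ α < (ω_ 1 : Ordinal.{u}), Order.IsSuccLimit α → s α = below s IsEven α

/-- A strategy of GOOD. The move of GOOD at an odd step `β` depends only on the moves made by BAD
at the even steps before `β`; these determine the earlier moves of GOOD as well. -/
def IsGoodStrategy (σ : Ordinal.{u} → (Ordinal.{u} → ZFSet.{u}) → ZFSet.{u}) : Prop :=
  ∀ (β : Ordinal.{u}) (s t : Ordinal.{u} → ZFSet.{u}),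
    (∀ γ < β, IsEven γ → s γ = t γ) → σ β s = σ β t

/-- With the moves `s` of BAD and `M` of GOOD (at odd steps), GOOD obeys the rules of the game with
parameters `h`, `b` on `(H κ; ∈, ≺*)` and wins it. -/
def GoodWins (T : Triple.{u}) {κ : Cardinal.{u}} (prec : H κ → H κ → Prop)
    (h b s M : Ordinal.{u} → ZFSet.{u}) : Prop :=
  (∀ α < (ω_ 1 : Ordinal.{u}), IsEven α →
    IsCountableElementary prec (M (α + 1)) ∧
      ({s α, h α, below M IsOdd α} : ZFSet.{u}) ∈ M (α + 1)) ∧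
  IsStationary {α | IsEven α ∧ T.Guesses (M (α + 1)) (b α)}

/-- The strategic diamond for `(A, B, E)` on `(H κ; ∈, ≺*)`. -/
def StrategicDiamond (T : Triple.{u}) {κ : Cardinal.{u}} (prec : H κ → H κ → Prop) : Prop :=
  ∀ h : Ordinal.{u} → ZFSet.{u}, (∀ α < (ω_ 1 : Ordinal.{u}), h α ∈ H κ) →
    ∃ b : Ordinal.{u} → ZFSet.{u}, (∀ α < (ω_ 1 : Ordinal.{u}), b α ∈ T.B) ∧
      ∃ σ, IsGoodStrategy σ ∧ ∀ s, IsBadRun s → GoodWins T prec h b s (fun β => σ β s)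

/-- A continuous sequence of elements of `H ω₁`. -/
def IsContinuousSeq (s : Ordinal.{u} → ZFSet.{u}) : Prop :=
  (∀ α < (ω_ 1 : Ordinal.{u}), s α ∈ H ℵ₁) ∧
    ∀ α < (ω_ 1 : Ordinal.{u}), Order.IsSuccLimit α → s α = below s (fun _ => True) α

/-- A sequence of the form `X ∩ α`, `α < ω₁`, for some `X ⊆ ω₁`. -/
def IsTraceSeq (s : Ordinal.{u} → ZFSet.{u}) : Prop :=
  ∃ X ⊆ (ω_ 1 : Ordinal.{u}).toZFSet,
    ∀ α < (ω_ 1 : Ordinal.{u}), s α = X ∩ α.toZFSet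

/-- The elementary diamond for `(A, B, E)` on `(H κ; ∈, ≺*)`, for the sequences `s` that
satisfy `P`. -/
def ElementaryDiamond (T : Triple.{u}) {κ : Cardinal.{u}} (prec : H κ → H κ → Prop)
    (P : (Ordinal.{u} → ZFSet.{u}) → Prop) : Prop :=
  ∀ h : Ordinal.{u} → ZFSet.{u}, (∀ α < (ω_ 1 : Ordinal.{u}), h α ∈ H κ) →
    ∃ b : Ordinal.{u} → ZFSet.{u}, (∀ α < (ω_ 1 : Ordinal.{u}), b α ∈ T.B) ∧
      ∀ s, P s → ∃ M : Ordinal.{u} → ZFSet.{u},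
        (∀ α < (ω_ 1 : Ordinal.{u}), IsCountableElementary prec (M α)) ∧
        (∀ α β : Ordinal.{u}, α ≤ β → β < ω_ 1 → M α ⊆ M β) ∧
        (∀ α < (ω_ 1 : Ordinal.{u}),
          ({s α, h α, below M (fun _ => True) α} : ZFSet.{u}) ∈ M (α + 1)) ∧
        IsStationary {α | T.Guesses (M (α + 1)) (b α)}

end GuessingModels

namespace GuessingModels

/-! Two facts about a countable $M\prec(H(\kappa);\in,\prec^*)$ drive all four implications: $M$
contains every point definable from its members (`mem_of_defTerm`), and every countable member of
$M$ is a subset of $M$ (`subset_of_countable`). Consequently guessing $A\cap M$ guesses every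
countable subset of $A$ that belongs to $M$, and a guess for $A\cap M$ is also a guess for $A\cap
M'$ whenever $M'\subseteq M$.

(1) → (2). The points definable from $x$ form an elementary submodel, the hull of $x$, because
$\prec^*$ supplies definable Skolem functions (`meetsDefinable_hullSet`). The truth predicate makes
$x\mapsto$ hull of $x$ definable (`defTerm_hull`). GOOD always plays the hull of the set required by
the rules. At a limit $\alpha$ the move of BAD is forced, so GOOD's answer depends only on BAD's
moves before $\alpha$. Those moves are coded by a set $X\subseteq\omega_1$ in such a way that
$X\cap\alpha$ determines them for club many $\alpha$ (`exists_code`). Hence $A\cap M_{\alpha+1}$ is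
a function of $X\cap\alpha$, definable with $\theta$ on each level, and the guesses provided by
$\Phi$ serve as $\mathcal B$.

(2) → (3). Round $\xi$ of the game consists of steps $2\xi$ and $2\xi+1$, and $2\alpha=\alpha$ at
limits. The sequence $X\cap\xi$ does not itself obey the limit rule for BAD, so BAD plays a
continuous sequence of tagged sets, from which a model recovers $X\cap\xi$ (`mem_of_tagSeq_mem`).
The models of the winning run, shifted by one at finite distance from limits, form the required
chain (`exists_chain`).

(3) → (4). A continuous sequence $s$ is coded by some $X$, and the chain $M$ for the traces of $X$
is thinned and reindexed: at $\beta$ one chooses the first model that contains $s_\beta$, $h_\beta$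
and the set of earlier choices. Such a model exists, since the recursion can be carried out inside
$M_{\delta+1}$ for large closed $\delta$ (`below_leastModel_mem`). For club many $\alpha$ the model
chosen at $\alpha$ has index at most $\alpha+1$, so it is contained in $M_{\alpha+1}$ and inherits
its guess.

(4) → (5). Let $h_\alpha$ list the parameters defining $F\restriction2^\alpha$ and let the
continuous sequence code the restrictions of $f$. Then $F(f\restriction\alpha)$ is a countable
member, hence a subset, of $M_{\alpha+1}$. -/

set_option linter.unusedSectionVars false

/-! ### Closure properties of `H κ` -/

/-- Uncountable regular cardinals. -/
class UncountableRegular (κ : Cardinal.{u}) : Prop where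
  isRegular : κ.IsRegular
  aleph0_lt : ℵ₀ < κ

instance : UncountableRegular.{u} ℵ₁ := ⟨isRegular_aleph_one, aleph0_lt_aleph_one⟩

theorem transClosure_eq (x : ZFSet.{u}) :
    transClosure x = (x : Set ZFSet.{u}) ∪ ⋃ y ∈ (x : Set ZFSet.{u}), transClosure y := by
  ext z
  simp only [transClosure, mem_union, mem_iUnion, SetLike.mem_coe, mem_ofPred_eq, exists_prop]
  rw [Relation.transGen_iff]
  simp only [and_comm]

theorem transClosure_mono {x y : ZFSet.{u}} (h : y ∈ x) : transClosure y ⊆ transClosure x := by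
  rw [transClosure_eq x]
  exact subset_union_of_subset_right (subset_biUnion_of_mem (u := transClosure) h) _

theorem H_trans {κ : Cardinal.{u}} {x y : ZFSet.{u}} (h : y ∈ x) (hx : x ∈ H κ) : y ∈ H κ :=
  (mk_le_mk_of_subset (transClosure_mono h)).trans_lt hx

theorem H_mono {κ μ : Cardinal.{u}} (h : κ ≤ μ) : H κ ⊆ H μ :=
  fun _ hx => lt_of_lt_of_le hx (Cardinal.lift_le.2 h)

theorem H_aleph_one_subset (κ : Cardinal.{u}) [hκ : UncountableRegular κ] : H ℵ₁ ⊆ H κ := by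
  apply H_mono
  rw [← succ_aleph0]
  exact Order.succ_le_of_lt hκ.aleph0_lt

theorem countable_transClosure {x : ZFSet.{u}} (hx : x ∈ H ℵ₁) : (transClosure x).Countable := by
  have : #(transClosure x) < lift.{u+1} ℵ₁ := hx
  rw [lift_aleph, Ordinal.lift_one, ← succ_aleph0, Order.lt_succ_iff] at this
  exact le_aleph0_iff_set_countable.1 this

/-- The transitive closure is the union of `x` and countably many transitive closures of size
$<\kappa$, so regularity and uncountability of $\kappa$ bound it. -/
theorem mem_H_of_countable {κ : Cardinal.{u}} [hκ : UncountableRegular κ] {x : ZFSet.{u}}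
    (hc : (x : Set ZFSet.{u}).Countable) (h : ∀ y ∈ x, y ∈ H κ) : x ∈ H κ := by
  have hr : (lift.{u+1} κ).IsRegular := hκ.isRegular.lift
  have h0 : #(x : Set ZFSet.{u}) < lift.{u+1} κ := by
    refine (le_aleph0_iff_set_countable.2 hc).trans_lt ?_
    simpa using Cardinal.lift_lt.{u,u+1}.2 hκ.aleph0_lt
  change #(transClosure x) < lift.{u+1} κ
  rw [transClosure_eq]
  refine (mk_union_le _ _).trans_lt (add_lt_of_lt hr.aleph0_le h0 ?_)
  rw [card_biUnion_lt_iff_forall_of_isRegular hr h0]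
  exact fun y hy => h y hy

section
variable {κ : Cardinal.{u}} [UncountableRegular κ] {x y z : ZFSet.{u}}

theorem empty_mem_H : ∅ ∈ H κ :=
  mem_H_of_countable (by simp) (by simp)

theorem insert_mem_H (hy : (y : Set ZFSet.{u}).Countable) (hx : x ∈ H κ) (h : y ∈ H κ) :
    insert x y ∈ H κ := by
  refine mem_H_of_countable (by simpa using hy) fun z hz => ?_
  rcases ZFSet.mem_insert_iff.1 hz with rfl | hz
  · exact hx
  · exact H_trans hz h

theorem singleton_mem_H (hx : x ∈ H κ) : ({x} : ZFSet) ∈ H κ :=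
  mem_H_of_countable (by simp) (by simpa using hx)

theorem pairSet_mem_H (hx : x ∈ H κ) (hy : y ∈ H κ) : ({x, y} : ZFSet) ∈ H κ :=
  insert_mem_H (by simp) hx (singleton_mem_H hy)

theorem tripleSet_mem_H (hx : x ∈ H κ) (hy : y ∈ H κ) (hz : z ∈ H κ) :
    ({x, y, z} : ZFSet) ∈ H κ :=
  insert_mem_H (by simp) hx (pairSet_mem_H hy hz)

theorem pair_mem_H (hx : x ∈ H κ) (hy : y ∈ H κ) : ZFSet.pair x y ∈ H κ :=
  pairSet_mem_H (singleton_mem_H hx) (pairSet_mem_H hx hy)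

end

theorem snd_mem_H {κ : Cardinal.{u}} {x y : ZFSet.{u}} (h : ZFSet.pair x y ∈ H κ) : y ∈ H κ :=
  H_trans (y := y) (x := {x, y}) (by simp) (H_trans (by simp [ZFSet.pair]) h)

theorem countable_Iio {α : Ordinal.{u}} (h : α < ω_ 1) : (Iio α).Countable := by
  rw [← le_aleph0_iff_set_countable, Cardinal.mk_Iio_ordinal, ← Cardinal.lift_aleph0.{u+1,u},
    Cardinal.lift_le, ← Order.lt_succ_iff, succ_aleph0, ← lt_ord]
  simpa using h

theorem countable_toZFSet {α : Ordinal.{u}} (h : α < ω_ 1) :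
    (α.toZFSet : Set ZFSet.{u}).Countable := by
  rw [Ordinal.coe_toZFSet]
  exact (countable_Iio h).image _

theorem countable_below {α : Ordinal.{u}} (h : α < ω_ 1) (f : Ordinal.{u} → ZFSet.{u})
    (P : Ordinal.{u} → Prop) : (below f P α : Set ZFSet.{u}).Countable := by
  refine ((countable_Iio h).image f).mono ?_
  intro x hx
  obtain ⟨β, hβ, -, rfl⟩ := mem_below.1 hx
  exact ⟨β, hβ, rfl⟩

theorem toZFSet_mem_H {κ : Cardinal.{u}} [UncountableRegular κ] {α : Ordinal.{u}}
    (h : α < ω_ 1) : α.toZFSet ∈ H κ := by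
  induction α using WellFoundedLT.induction with
  | ind α ih =>
    refine mem_H_of_countable (countable_toZFSet h) fun y hy => ?_
    obtain ⟨β, hβ, rfl⟩ := Ordinal.mem_toZFSet_iff.1 hy
    exact ih β hβ (hβ.trans h)

theorem below_mem_H {κ : Cardinal.{u}} [UncountableRegular κ] {α : Ordinal.{u}} (h : α < ω_ 1)
    {f : Ordinal.{u} → ZFSet.{u}} {P : Ordinal.{u} → Prop}
    (hf : ∀ β < α, P β → f β ∈ H κ) : below f P α ∈ H κ := by
  refine mem_H_of_countable (countable_below h f P) fun y hy => ?_
  obtain ⟨β, hβ, hP, rfl⟩ := mem_below.1 hy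
  exact hf β hβ hP

theorem natSet_mem_H {κ : Cardinal.{u}} [UncountableRegular κ] (n : ℕ) : natSet n ∈ H κ :=
  toZFSet_mem_H ((Ordinal.natCast_lt_omega0 n).trans Ordinal.omega0_lt_omega_one)

/-! ### Definable predicates and terms over structures on `H κ` -/

/-- The membership relation of `H κ` is definable in the language `L`. -/
class MemDefinable (κ : Cardinal.{u}) (L : FirstOrder.Language.{0, 0}) [L.Structure (H κ)] :
    Prop where
  mem_definable : (∅ : Set (H κ)).Definable L {v : Fin 2 → H κ | (v 0).1 ∈ (v 1).1}

section
variable {κ : Cardinal.{u}} (L : FirstOrder.Language.{0, 0}) [L.Structure (H κ)] (A : Set (H κ))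
  {ι ι' : Type*}

/-- A predicate on tuples is definable with parameters in `A`. -/
def DefPred (P : (ι → H κ) → Prop) : Prop := A.Definable L {v | P v}

/-- A function from tuples to elements of `H κ` is definable with parameters in `A`. -/
def DefTerm (t : (ι → H κ) → ZFSet.{u}) : Prop :=
  (∀ v, t v ∈ H κ) ∧
    DefPred L A (fun w : Option ι → H κ => (w none).1 = t (fun i => w (some i)))

variable {L A} {P Q : (ι → H κ) → Prop} {s t : (ι → H κ) → ZFSet.{u}}

namespace DefPred

theorem congr (h : DefPred L A P) (e : ∀ v, Q v ↔ P v) : DefPred L A Q := by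
  have : Q = P := funext fun v => propext (e v)
  rwa [this]

theorem and (h : DefPred L A P) (h' : DefPred L A Q) : DefPred L A fun v => P v ∧ Q v :=
  Definable.inter h h'

theorem or (h : DefPred L A P) (h' : DefPred L A Q) : DefPred L A fun v => P v ∨ Q v :=
  Definable.union h h'

theorem not (h : DefPred L A P) : DefPred L A fun v => ¬ P v :=
  Definable.compl h

theorem imp (h : DefPred L A P) (h' : DefPred L A Q) : DefPred L A fun v => P v → Q v :=
  (h.not.or h').congr fun _ => imp_iff_not_or

theorem iff (h : DefPred L A P) (h' : DefPred L A Q) : DefPred L A fun v => (P v ↔ Q v) :=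
  ((h.imp h').and (h'.imp h)).congr fun _ => iff_iff_implies_and_implies

theorem reindex (h : DefPred L A P) (f : ι → ι') :
    DefPred L A fun w : ι' → H κ => P (fun i => w (f i)) :=
  Definable.preimage_comp f h

theorem realize (φ : L.Formula ι) : DefPred L A φ.Realize :=
  (empty_definable_iff.2 ⟨φ, rfl⟩ : (∅ : Set (H κ)).Definable L _).mono (empty_subset A)

theorem allFinite [Finite ι'] {P : ι' → (ι → H κ) → Prop} (h : ∀ i, DefPred L A (P i)) :
    DefPred L A fun v => ∀ i, P i v := by
  rw [DefPred, show {v | ∀ i, P i v} = ⋂ i, {v | P i v} by ext; simp]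
  exact definable_iInter_of_finite h

theorem exFinite [Finite ι'] {P : (ι → H κ) → (ι' → H κ) → Prop}
    (h : DefPred L A fun w : ι ⊕ ι' → H κ => P (fun i => w (.inl i)) fun i => w (.inr i)) :
    DefPred L A fun v => ∃ w, P v w :=
  DefPred.congr (Definable.exists_of_finite h) fun _ => Iff.rfl

variable [Finite ι]

/-- Variables are indexed by a finite type, and a quantifier binds the extra coordinate `none` of
`Option ι`. Definability of a formula is then proved by following its syntax, with `some` as
weakening. -/
theorem ex {P : (ι → H κ) → H κ → Prop}
    (h : DefPred L A fun w : Option ι → H κ => P (fun i => w (some i)) (w none)) :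
    DefPred L A fun v => ∃ x, P v x := by
  refine DefPred.congr (Definable.image_comp_embedding h Function.Embedding.some) fun v => ?_
  constructor
  · rintro ⟨x, hx⟩
    exact ⟨fun o => o.elim x v, hx, rfl⟩
  · rintro ⟨w, hw, rfl⟩
    exact ⟨w none, hw⟩

theorem all {P : (ι → H κ) → H κ → Prop}
    (h : DefPred L A fun w : Option ι → H κ => P (fun i => w (some i)) (w none)) :
    DefPred L A fun v => ∀ x, P v x :=
  (ex (P := fun v x => ¬ P v x) h.not).not.congr fun v => by simp

theorem exH {P : (ι → H κ) → ZFSet.{u} → Prop}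
    (h : DefPred L A fun w : Option ι → H κ => P (fun i => w (some i)) (w none).1) :
    DefPred L A fun v => ∃ x ∈ H κ, P v x :=
  (ex (P := fun v x => P v x.1) h).congr fun v => by simp

theorem allH {P : (ι → H κ) → ZFSet.{u} → Prop}
    (h : DefPred L A fun w : Option ι → H κ => P (fun i => w (some i)) (w none).1) :
    DefPred L A fun v => ∀ x ∈ H κ, P v x :=
  (all (P := fun v x => P v x.1) h).congr fun v => by simp

end DefPred

theorem DefTerm.reindex (h : DefTerm L A t) (f : ι → ι') :
    DefTerm L A fun w : ι' → H κ => t (fun i => w (f i)) :=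
  ⟨fun _ => h.1 _, DefPred.reindex h.2 (Option.map f)⟩

theorem DefTerm.congr (h : DefTerm L A t) (e : ∀ v, s v = t v) : DefTerm L A s := by
  rwa [show s = t from funext e]

variable [Finite ι] [MemDefinable κ L]

theorem DefPred.mem_var (i j : ι) : DefPred L A fun v => (v i).1 ∈ (v j).1 :=
  ((Definable.mono (MemDefinable.mem_definable (κ := κ) (L := L)) (empty_subset A)).preimage_comp ![i, j] :)

/-- Equality is expressed through membership, which is correct because $H(\kappa)$ is transitive and
so satisfies extensionality. -/
theorem DefPred.eq_var (i j : ι) : DefPred L A fun v => (v i).1 = (v j).1 := by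
  refine DefPred.congr (P := fun v => ∀ x, x.1 ∈ (v i).1 ↔ x.1 ∈ (v j).1)
    (DefPred.all ((DefPred.mem_var _ _).iff (DefPred.mem_var _ _))) fun v => ?_
  constructor
  · rintro h x
    rw [h]
  · intro h
    ext z
    constructor
    · exact fun hz => (h ⟨z, H_trans hz (v i).2⟩).1 hz
    · exact fun hz => (h ⟨z, H_trans hz (v j).2⟩).2 hz

theorem DefTerm.var (i : ι) : DefTerm L A fun v => (v i).1 :=
  ⟨fun v => (v i).2, DefPred.eq_var _ _⟩

theorem DefTerm.const {c : ZFSet.{u}} (hc : c ∈ H κ) (h : (⟨c, hc⟩ : H κ) ∈ A) :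
    DefTerm L A fun _ : ι → H κ => c := by
  refine ⟨fun _ => hc, ?_⟩
  refine DefPred.congr (Definable.preimage_comp (fun _ : Fin 1 => (none : Option ι))
    (Definable.singleton_of_mem L h)) fun v => ?_
  simp [Subtype.ext_iff]

theorem DefTerm.constU {c : ZFSet.{u}} (hc : c ∈ H κ) :
    DefTerm L univ fun _ : ι → H κ => c :=
  DefTerm.const hc (mem_univ _)

/-- Substitution of a term for a variable. -/
theorem DefPred.subst (hs : DefTerm L A s) {P : (ι → H κ) → ZFSet.{u} → Prop}
    (h : DefPred L A fun w : Option ι → H κ => P (fun i => w (some i)) (w none).1) :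
    DefPred L A fun v => P v (s v) := by
  refine DefPred.congr (DefPred.ex (P := fun v x => x.1 = s v ∧ P v x.1) (hs.2.and h)) fun v => ?_
  constructor
  · exact fun hv => ⟨⟨s v, hs.1 v⟩, rfl, hv⟩
  · rintro ⟨x, hx, hv⟩
    rwa [← hx]

theorem DefPred.mem (hs : DefTerm L A s) (ht : DefTerm L A t) :
    DefPred L A fun v => s v ∈ t v := by
  refine DefPred.subst hs (P := fun v x => x ∈ t v) ?_
  refine DefPred.subst (ht.reindex some)
    (P := fun (w : Option ι → H κ) y => (w none).1 ∈ y) ?_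
  exact DefPred.mem_var _ _

theorem DefPred.eq (hs : DefTerm L A s) (ht : DefTerm L A t) :
    DefPred L A fun v => s v = t v := by
  refine DefPred.subst ht (P := fun v x => s v = x) ?_
  exact hs.2.congr fun w => eq_comm

/-- By transitivity of $H(\kappa)$, a bounded quantifier over all sets is the same as one over
$H(\kappa)$. -/
theorem DefPred.exMem {P : (ι → H κ) → ZFSet.{u} → Prop} (ht : DefTerm L A t)
    (h : DefPred L A fun w : Option ι → H κ => P (fun i => w (some i)) (w none).1) :
    DefPred L A fun v => ∃ x ∈ t v, P v x := by
  refine DefPred.congr (P := fun v => ∃ x ∈ H κ, x ∈ t v ∧ P v x)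
    (DefPred.exH ((DefPred.mem (DefTerm.var _) (ht.reindex some)).and h)) fun v => ?_
  constructor
  · rintro ⟨x, hx, h⟩
    exact ⟨x, H_trans hx (ht.1 v), hx, h⟩
  · rintro ⟨x, -, h⟩
    exact ⟨x, h⟩

theorem DefPred.allMem {P : (ι → H κ) → ZFSet.{u} → Prop} (ht : DefTerm L A t)
    (h : DefPred L A fun w : Option ι → H κ => P (fun i => w (some i)) (w none).1) :
    DefPred L A fun v => ∀ x ∈ t v, P v x :=
  (DefPred.exMem (P := fun v x => ¬ P v x) ht h.not).not.congr fun v => by simp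

/-- A function is definable if membership in its values is. -/
theorem DefTerm.of_mem_iff {Q : (ι → H κ) → ZFSet.{u} → Prop} (hH : ∀ v, t v ∈ H κ)
    (h : ∀ v, ∀ x ∈ H κ, x ∈ t v ↔ Q v x)
    (hd : DefPred L A fun w : Option ι → H κ => Q (fun i => w (some i)) (w none).1) :
    DefTerm L A t := by
  refine ⟨hH, ?_⟩
  refine DefPred.congr
    (P := fun w : Option ι → H κ => ∀ x ∈ H κ, x ∈ (w none).1 ↔ Q (fun i => w (some i)) x)
    (DefPred.allH ((DefPred.mem_var _ _).iff (hd.reindex fun o => o.elim none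
      fun i => some (some i)))) fun w => ?_
  constructor
  · rintro e x hx
    rw [e, h _ x hx]
  · intro e
    ext z
    constructor
    · intro hz
      have := H_trans hz (w none).2
      exact (h _ z this).2 ((e z this).1 hz)
    · intro hz
      have := H_trans hz (hH _)
      exact (e z this).2 ((h _ z this).1 hz)

variable [UncountableRegular κ]

theorem DefTerm.singleton (hs : DefTerm L A s) : DefTerm L A fun v => ({s v} : ZFSet) :=
  DefTerm.of_mem_iff (fun v => singleton_mem_H (hs.1 v)) (fun _ _ _ => ZFSet.mem_singleton)
    (.eq (.var _) (hs.reindex some))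

theorem DefTerm.pairSet (hs : DefTerm L A s) (ht : DefTerm L A t) :
    DefTerm L A fun v => ({s v, t v} : ZFSet) :=
  DefTerm.of_mem_iff (fun v => pairSet_mem_H (hs.1 v) (ht.1 v)) (fun _ _ _ => ZFSet.mem_pair)
    (.or (.eq (.var _) (hs.reindex some)) (.eq (.var _) (ht.reindex some)))

theorem DefTerm.tripleSet {r : (ι → H κ) → ZFSet.{u}} (hs : DefTerm L A s) (ht : DefTerm L A t)
    (hr : DefTerm L A r) : DefTerm L A fun v => ({s v, t v, r v} : ZFSet) :=
  DefTerm.of_mem_iff (fun v => tripleSet_mem_H (hs.1 v) (ht.1 v) (hr.1 v))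
    (fun _ _ _ => (ZFSet.mem_insert_iff.trans (or_congr Iff.rfl ZFSet.mem_pair)))
    (.or (.eq (.var _) (hs.reindex some))
      (.or (.eq (.var _) (ht.reindex some)) (.eq (.var _) (hr.reindex some))))

theorem DefTerm.pair (hs : DefTerm L A s) (ht : DefTerm L A t) :
    DefTerm L A fun v => ZFSet.pair (s v) (t v) :=
  (hs.singleton.pairSet (hs.pairSet ht) :)

end

/-! ### The structures on `H κ` -/

theorem definable_relMap {M : Type*} {L : FirstOrder.Language.{0, 0}} [L.Structure M] (A : Set M)
    (R : L.Relations 2) :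
    A.Definable L {v : Fin 2 → M | FirstOrder.Language.Structure.RelMap R v} := by
  refine Definable.mono (A := ∅) ?_ (empty_subset A)
  rw [empty_definable_iff]
  refine ⟨R.formula₂ (.var 0) (.var 1), ?_⟩
  ext v
  simp only [mem_ofPred_eq, FirstOrder.Language.Formula.realize_rel₂,
    FirstOrder.Language.Term.realize_var]
  rw [show ![v 0, v 1] = v from by ext i; fin_cases i <;> rfl]

section
variable {κ : Cardinal.{u}} (prec : H κ → H κ → Prop)

theorem memDefinable_ordStr : letI := ordStr prec; MemDefinable κ ordLang :=
  let := ordStr prec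
  ⟨(definable_relMap (M := H κ) (L := ordLang) ∅ OrdRel.mem :)⟩

theorem memDefinable_truthStr : letI := truthStr prec; MemDefinable κ truthLang :=
  let := truthStr prec
  ⟨(definable_relMap (M := H κ) (L := truthLang) ∅ TruthRel.mem :)⟩

theorem defPred_prec {ι : Type*} (A : Set (H κ)) (i j : ι) : letI := ordStr prec
    DefPred ordLang A fun v : ι → H κ => prec (v i) (v j) :=
  let := ordStr prec
  ((definable_relMap (L := ordLang) A OrdRel.prec).preimage_comp ![i, j] :)

theorem defPred_truth {ι : Type*} (A : Set (H κ)) (i j : ι) : letI := truthStr prec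
    DefPred truthLang A fun v : ι → H κ => truth prec (v i) (v j) :=
  let := truthStr prec
  ((definable_relMap (L := truthLang) A TruthRel.truth).preimage_comp ![i, j] :)

/-- The inclusion of the symbols of `{∈}` in those of `{∈, ≺*, θ}`. -/
def setRelToTruth : ∀ {n : ℕ}, SetRel n → TruthRel n
  | _, .mem => .mem

/-- The inclusion of the language `{∈}` in the language `{∈, ≺*, θ}`. -/
def setToTruth : setLang →ᴸ truthLang where
  onFunction := fun _ f => nomatch f
  onRelation := fun _ R => setRelToTruth R

theorem definableSubset_truth {D : ZFSet.{u}} (hD : DefinableSubset κ D) {ι : Type*} (i : ι) :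
    letI := truthStr prec
    DefPred truthLang univ fun v : ι → H κ => (v i).1 ∈ D := by
  let := setStr κ
  let := truthStr prec
  have : setToTruth.IsExpansionOn (H κ) :=
    { map_onFunction := fun f => nomatch f
      map_onRelation := fun R _ => by
        cases R
        rfl }
  exact (Definable.map_expansion hD.2 setToTruth).preimage_comp (fun _ : Fin 1 => i)

end

/-! ### Countable elementary submodels -/

namespace IsCountableElementary

variable {κ : Cardinal.{u}} [UncountableRegular κ] {prec : H κ → H κ → Prop} {M : ZFSet.{u}}

/-- The members of `M` as elements of `H κ`. -/
abbrev carrier (κ : Cardinal.{u}) (M : ZFSet.{u}) : Set (H κ) := {x | x.1 ∈ M}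

variable (hM : IsCountableElementary prec M)
include hM

theorem subset_H {x : ZFSet.{u}} (hx : x ∈ M) : x ∈ H κ := by
  obtain ⟨-, S, hS⟩ := hM
  have : x ∈ (M : Set ZFSet.{u}) := hx
  rw [← hS] at this
  obtain ⟨y, -, rfl⟩ := this
  exact y.2

/-- The Tarski–Vaught property of $M$, in the form in which elementarity is used from here on. -/
theorem exists_mem {P : ZFSet.{u} → Prop}
    (hP : letI := ordStr prec
      DefPred ordLang (carrier κ M) fun w : Option Empty → H κ => P (w none).1)
    (h : ∃ x ∈ H κ, P x) : ∃ x ∈ M, P x := by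
  let := ordStr prec
  obtain ⟨-, S, hS⟩ := hM
  have hS' : (S : Set (H κ)) = carrier κ M := by
    ext x
    change _ ↔ x.1 ∈ (M : Set ZFSet.{u})
    rw [← hS]
    simp
  have h1 := S.meetsDefinable {x | P x.1} (by obtain ⟨x, hx, h⟩ := h; exact ⟨⟨x, hx⟩, h⟩)
    (by rw [hS']; exact hP.reindex (fun _ => (0 : Fin 1)))
  obtain ⟨x, hx, hxS⟩ := h1
  rw [hS'] at hxS
  exact ⟨x.1, hxS, hx⟩

theorem mem_of_defTerm {y : ZFSet.{u}}
    (hy : letI := ordStr prec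
      DefTerm ordLang (carrier κ M) fun _ : Empty → H κ => y) : y ∈ M := by
  let := ordStr prec
  obtain ⟨x, hx, rfl⟩ := hM.exists_mem (P := fun x => x = y) hy.2
    ⟨y, hy.1 (fun i => i.elim), rfl⟩
  exact hx

theorem defTerm_const {y : ZFSet.{u}} (hy : y ∈ M) {ι : Type*} [Finite ι] :
    letI := ordStr prec; DefTerm ordLang (carrier κ M) fun _ : ι → H κ => y :=
  let := ordStr prec
  have := memDefinable_ordStr prec
  DefTerm.const (hM.subset_H hy) hy

theorem natSet_mem (n : ℕ) : natSet n ∈ M := by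
  let := ordStr prec
  have := memDefinable_ordStr prec
  refine hM.mem_of_defTerm ?_
  induction n with
  | zero =>
    refine DefTerm.of_mem_iff (Q := fun _ x => x ≠ x) (fun _ => natSet_mem_H 0)
      (by simp [natSet]) ?_
    exact .not (.eq (.var _) (.var _))
  | succ n ih =>
    refine DefTerm.of_mem_iff (Q := fun v x => x = natSet n ∨ x ∈ natSet n)
      (fun _ => natSet_mem_H _) (fun _ x _ => by simp [natSet, ZFSet.mem_insert_iff]) ?_
    exact .or (.eq (.var _) (ih.reindex fun i => i.elim)) (.mem (.var _) (ih.reindex fun i => i.elim))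

/-- Countable members of `M` are subsets of `M`. -/
theorem subset_of_countable {c : ZFSet.{u}} (hc : c ∈ M) (hcc : (c : Set ZFSet.{u}).Countable) :
    c ⊆ M := by
  let := ordStr prec
  have := memDefinable_ordStr prec
  rcases ZFSet.eq_empty_or_nonempty c with rfl | hne
  · exact ZFSet.empty_subset _
  have hcH := hM.subset_H hc
  obtain ⟨f, hf⟩ := hcc.exists_eq_range hne
  have hfH : ∀ n, f n ∈ H κ := fun n => H_trans (x := c)
    (by rw [← SetLike.mem_coe, hf]; exact ⟨n, rfl⟩) hcH
  -- The intended `x` is $\omega$ and the intended `e` an enumeration of `c`. It is enough that each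
  -- member of `x` is empty or the successor of a member of `x`: by ∈-induction this already makes
  -- all members of `x` natural numbers. The existence of `e` is part of the formula, so that an `e`
  -- suited to this `x` can afterwards be found in `M`.
  obtain ⟨x, hxM, hx, hx'⟩ := hM.exists_mem (P := fun x =>
      (∀ n ∈ x, (∀ u ∈ H κ, u ∉ n) ∨ ∃ m ∈ x, ∀ u ∈ H κ, u ∈ n ↔ u = m ∨ u ∈ m) ∧
      ∃ e ∈ H κ, ∀ u ∈ c, ∃ n ∈ x, ∀ u' ∈ H κ, ZFSet.pair n u' ∈ e ↔ u' = u) (by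
    refine .and (.allMem (.var _) (.or (.allH (.not (.mem (.var _) (.var _))))
      (.exMem (.var _) (.allH (.iff (.mem (.var _) (.var _)) (.or (.eq (.var _) (.var _))
        (.mem (.var _) (.var _)))))))) ?_
    exact .exH (.allMem (hM.defTerm_const hc) (.exMem (.var _) (.allH (.iff
      (.mem (.pair (.var _) (.var _)) (.var _)) (.eq (.var _) (.var _)))))))
    (by
      refine ⟨ZFSet.range natSet.{u}, mem_H_of_countable ?_ ?_, ?_,
        ZFSet.range (fun n => ZFSet.pair (natSet n) (f n)), mem_H_of_countable ?_ ?_, ?_⟩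
      · rw [ZFSet.coe_range]; exact countable_range _
      · rintro y hy
        obtain ⟨n, rfl⟩ := ZFSet.mem_range.1 hy
        exact natSet_mem_H n
      · rintro y hy
        obtain ⟨n, rfl⟩ := ZFSet.mem_range.1 hy
        cases n with
        | zero => left; simp [natSet]
        | succ n =>
          right
          exact ⟨natSet n, ZFSet.mem_range_self (f := natSet.{u}) n, by simp [natSet]⟩
      · rw [ZFSet.coe_range]; exact countable_range _
      · rintro y hy
        obtain ⟨n, rfl⟩ := ZFSet.mem_range.1 hy
        exact pair_mem_H (natSet_mem_H n) (hfH n)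
      · intro u hu
        rw [← SetLike.mem_coe, hf] at hu
        obtain ⟨n, rfl⟩ := hu
        refine ⟨natSet n, ZFSet.mem_range_self (f := natSet.{u}) n, fun u' _ => ?_⟩
        simp only [ZFSet.mem_range, ZFSet.pair_inj]
        constructor
        · rintro ⟨m, h1, rfl⟩
          rw [natSet_injective h1]
        · rintro rfl
          exact ⟨n, rfl, rfl⟩)
  have hnat : ∀ n, n ∈ x → ∃ k, n = natSet k := by
    intro n
    induction n using ZFSet.inductionOn with
    | h n ih =>
      intro hn
      have hnH := H_trans hn (hM.subset_H hxM)
      rcases hx n hn with h0 | ⟨m, hm, h⟩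
      · exact ⟨0, by
          simp only [natSet, Nat.cast_zero, Ordinal.toZFSet_zero]
          exact (ZFSet.eq_empty n).2 fun y hy => h0 y (H_trans hy hnH) hy⟩
      · have hmH := H_trans hm (hM.subset_H hxM)
        obtain ⟨k, rfl⟩ := ih m ((h m hmH).2 (Or.inl rfl)) hm
        refine ⟨k + 1, ?_⟩
        ext u
        simp only [natSet, Nat.cast_add, Nat.cast_one, Ordinal.toZFSet_add_one,
          ZFSet.mem_insert_iff]
        constructor
        · exact fun hu => (h u (H_trans hu hnH)).1 hu
        · rintro (rfl | hu)
          · exact (h _ hmH).2 (Or.inl rfl)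
          · exact (h u (H_trans hu hmH)).2 (Or.inr hu)
  obtain ⟨e, heM, he⟩ := hM.exists_mem (P := fun e =>
      ∀ u ∈ c, ∃ n ∈ x, ∀ u' ∈ H κ, ZFSet.pair n u' ∈ e ↔ u' = u) (by
    exact .allMem (hM.defTerm_const hc) (.exMem (hM.defTerm_const hxM) (.allH (.iff
      (.mem (.pair (.var _) (.var _)) (.var _)) (.eq (.var _) (.var _)))))) hx'
  intro u hu
  have huH := H_trans hu hcH
  obtain ⟨n, hn, h⟩ := he u hu
  obtain ⟨k, rfl⟩ := hnat n hn
  -- `e` and the number `k` lie in `M`, so `M` contains some value of `e` at `k`; the only value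
  -- there is `u`.
  obtain ⟨y, hyM, hy⟩ := hM.exists_mem (P := fun y => ZFSet.pair (natSet k) y ∈ e) (by
    exact .mem (.pair (hM.defTerm_const (hM.natSet_mem k)) (.var _)) (hM.defTerm_const heM))
    ⟨u, huH, (h u huH).2 rfl⟩
  rwa [← (h y (hM.subset_H hyM)).1 hy]

theorem tripleSet_mem {x y z : ZFSet.{u}} (hx : x ∈ M) (hy : y ∈ M) (hz : z ∈ M) :
    ({x, y, z} : ZFSet) ∈ M := by
  let := ordStr prec
  have := memDefinable_ordStr prec
  exact hM.mem_of_defTerm (.tripleSet (hM.defTerm_const hx) (hM.defTerm_const hy)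
    (hM.defTerm_const hz))

theorem of_tripleSet_mem {x y z : ZFSet.{u}} (h : ({x, y, z} : ZFSet) ∈ M) :
    x ∈ M ∧ y ∈ M ∧ z ∈ M := by
  have := hM.subset_of_countable h (by simp)
  exact ⟨this (by simp), this (by simp), this (by simp)⟩

end IsCountableElementary

/-! ### Skolem hulls of a point -/

/-- The elements of `H κ` that are definable over `(H κ; ∈, ≺*)` from `x`. -/
def hullSet {κ : Cardinal.{u}} (prec : H κ → H κ → Prop) (x : H κ) : Set (H κ) :=
  letI := ordStr prec
  {y | ∃ φ : ordLang.Formula (Fin 2), φ.Realize ![x, y] ∧ ∀ y', φ.Realize ![x, y'] → y' = y}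

section
variable {κ : Cardinal.{u}} {prec : H κ → H κ → Prop}

theorem countable_ordLang_formula (n : ℕ) : Countable (ordLang.Formula (Fin n)) :=
  godelNumber_injective.countable

theorem countable_hullSet (x : H κ) : (hullSet prec x).Countable := by
  let := ordStr prec
  have := countable_ordLang_formula 2
  choose φ h1 h2 using fun y : hullSet prec x => y.2
  have : Function.Injective φ := fun y z h => Subtype.ext (h2 z _ (h ▸ h1 y))
  exact this.countable

theorem self_mem_hullSet (x : H κ) : x ∈ hullSet prec x := by
  let := ordStr prec
  refine ⟨(FirstOrder.Language.Term.var 0).equal (.var 1), ?_, fun y => ?_⟩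
  · simp
  · simp [eq_comm]

/-- The $\prec^*$-least element of `D` is definable from the finitely many parameters of `D`. Each
of these is definable from `x`, so the element itself is definable from `x`. -/
theorem meetsDefinable_hullSet [hprec : IsWellOrder _ prec] (x : H κ) :
    letI := ordStr prec; ordLang.MeetsDefinable (hullSet prec x) := by
  let := ordStr prec
  rintro D hD hdef
  obtain ⟨A, hA, hdef⟩ := definable_iff_finitely_definable.1 hdef
  obtain ⟨d, hd, hmin⟩ := hprec.wf.has_min D hD
  refine ⟨d, hd, ?_⟩
  have hmin' : ∀ y, y = d ↔ y ∈ D ∧ ∀ z, prec z y → z ∉ D := by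
    intro y
    constructor
    · rintro rfl
      exact ⟨hd, fun z hz hzD => hmin z hzD hz⟩
    · rintro ⟨hy, h⟩
      rcases trichotomous_of prec y d with h1 | h1 | h1
      · exact (hmin y hy h1).elim
      · exact h1
      · exact (h d h1 hd).elim
  have h1 : DefPred ordLang (A : Set (H κ)) fun v : Fin 1 → H κ => v 0 = d := by
    refine DefPred.congr (P := fun v : Fin 1 → H κ => v 0 ∈ D ∧ ∀ z, prec z (v 0) → z ∉ D) ?_
      fun v => hmin' (v 0)
    refine .and hdef (.all (.imp (defPred_prec prec _ _ _) (.not ?_)))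
    exact DefPred.reindex hdef fun _ => none
  obtain ⟨ψ, hψ⟩ := definable_iff_exists_formula_sum.1 h1
  replace hψ : ∀ v : Fin 1 → H κ, v 0 = d ↔ ψ.Realize (Sum.elim (fun a : A => (a : H κ)) v) :=
    fun v => Set.ext_iff.1 hψ v
  have hψ' : ∀ y, ψ.Realize (Sum.elim (fun a : A => (a : H κ)) fun _ => y) ↔ y = d :=
    fun y => (hψ fun _ => y).symm
  choose φ hφ hφ' using fun a : A => hA a.2
  -- The parameters are eliminated by quantifying over tuples `w` that satisfy their defining
  -- formulas; for `v 0 = x` the only such tuple is the original one.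
  have h2 : DefPred ordLang (∅ : Set (H κ)) fun v : Fin 2 → H κ =>
      ∃ w : A → H κ, (∀ a, (φ a).Realize ![v 0, w a]) ∧ ψ.Realize (Sum.elim w fun _ => v 1) := by
    refine DefPred.exFinite (P := fun (v : Fin 2 → H κ) (w : A → H κ) =>
      (∀ a, (φ a).Realize ![v 0, w a]) ∧ ψ.Realize (Sum.elim w fun _ => v 1)) ?_
    refine .and (.allFinite fun a => ?_) ?_
    · refine ((DefPred.realize (φ a)).reindex ![.inl 0, .inr a]).congr fun v => ?_
      rw [iff_iff_eq]
      congr 1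
      ext i
      fin_cases i <;> rfl
    · refine ((DefPred.realize ψ).reindex (Sum.elim .inr fun _ => .inl 1)).congr fun v => ?_
      rw [iff_iff_eq]
      congr 1
      ext i
      cases i <;> rfl
  obtain ⟨χ, hχ⟩ := empty_definable_iff.1 h2
  replace hχ : ∀ v : Fin 2 → H κ, χ.Realize v ↔ _ := fun v => (Set.ext_iff.1 hχ v).symm
  have key : ∀ y, χ.Realize ![x, y] ↔ y = d := by
    intro y
    rw [hχ, ← hψ' y]
    constructor
    · rintro ⟨w, hw, h⟩
      rwa [show w = fun a : A => (a : H κ) from funext fun a => hφ' a _ (hw a)] at h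
    · intro h
      exact ⟨_, hφ, h⟩
  exact ⟨χ, (key d).2 rfl, fun y => (key y).1⟩

variable [UncountableRegular κ] (prec)

/-- The elements of `H κ` that are definable over `(H κ; ∈, ≺*)` from `x`, as a set. -/
noncomputable def hull (x : ZFSet.{u}) : ZFSet.{u} :=
  open Classical in
  if hx : x ∈ H κ then
    haveI : Countable (hullSet prec ⟨x, hx⟩) := countable_hullSet _
    ZFSet.range fun y : hullSet prec ⟨x, hx⟩ => y.1.1
  else ∅

theorem mem_hull {x y : ZFSet.{u}} (hx : x ∈ H κ) :
    y ∈ hull prec x ↔ ∃ hy : y ∈ H κ, ⟨y, hy⟩ ∈ hullSet prec ⟨x, hx⟩ := by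
  have : Countable (hullSet prec ⟨x, hx⟩) := countable_hullSet _
  rw [hull, dif_pos hx, ZFSet.mem_range]
  constructor
  · rintro ⟨y, rfl⟩
    exact ⟨y.1.2, y.2⟩
  · rintro ⟨hy, h⟩
    exact ⟨⟨_, h⟩, rfl⟩

theorem hull_subset_H {x y : ZFSet.{u}} (h : y ∈ hull prec x) : y ∈ H κ := by
  by_cases hx : x ∈ H κ
  · exact ((mem_hull prec hx).1 h).1
  · rw [hull, dif_neg hx] at h
    exact (ZFSet.notMem_empty _ h).elim

theorem countable_hull (x : ZFSet.{u}) : (hull prec x : Set ZFSet.{u}).Countable := by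
  by_cases hx : x ∈ H κ
  · have : Countable (hullSet prec ⟨x, hx⟩) := countable_hullSet _
    rw [hull, dif_pos hx, ZFSet.coe_range]
    exact countable_range _
  · rw [hull, dif_neg hx]
    simp

theorem hull_mem_H (x : ZFSet.{u}) : hull prec x ∈ H κ :=
  mem_H_of_countable (countable_hull prec x) fun _ => hull_subset_H prec

theorem self_mem_hull {x : ZFSet.{u}} (hx : x ∈ H κ) : x ∈ hull prec x :=
  (mem_hull prec hx).2 ⟨hx, self_mem_hullSet _⟩

theorem isCountableElementary_hull [IsWellOrder _ prec] {x : ZFSet.{u}} (hx : x ∈ H κ) :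
    IsCountableElementary prec (hull prec x) := by
  let := ordStr prec
  have h := meetsDefinable_hullSet (prec := prec) ⟨x, hx⟩
  refine ⟨countable_hull prec x, h.toElementarySubstructure, ?_⟩
  change Subtype.val '' (FirstOrder.Language.Substructure.closure ordLang
    (hullSet prec ⟨x, hx⟩) : Set (H κ)) = _
  rw [h.closure_eq_self]
  ext y
  rw [SetLike.mem_coe, mem_hull prec hx]
  simp

theorem tuple_pair (x y : ZFSet.{u}) :
    tuple ![x, y] = {ZFSet.pair (natSet 0) x, ZFSet.pair (natSet 1) y} := by
  ext z
  simp [tuple, eq_comm]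

/-- The quantifier over formulas becomes a quantifier over sets `c`. No restriction on `c` is
needed, since the truth predicate holds only of codes of formulas. -/
theorem mem_hull_iff_truth {x y : ZFSet.{u}} (hx : x ∈ H κ) (hy : y ∈ H κ) :
    y ∈ hull prec x ↔ ∃ c : H κ, (∃ t : H κ, t.1 = tuple ![x, y] ∧ truth prec c t) ∧
      ∀ y' ∈ H κ, (∃ t : H κ, t.1 = tuple ![x, y'] ∧ truth prec c t) → y' = y := by
  let := ordStr prec
  have ht : ∀ {x y}, x ∈ H κ → y ∈ H κ → tuple ![x, y] ∈ H κ := fun hx hy => by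
    rw [tuple_pair]
    exact pairSet_mem_H (pair_mem_H (natSet_mem_H _) hx) (pair_mem_H (natSet_mem_H _) hy)
  have key : ∀ (φ : ordLang.Formula (Fin 2)) (y) (hy : y ∈ H κ),
      (∃ t : H κ, t.1 = tuple ![x, y] ∧ truth prec ⟨natSet (godelNumber φ), natSet_mem_H _⟩ t) ↔
        φ.Realize ![(⟨x, hx⟩ : H κ), ⟨y, hy⟩] := by
    intro φ y hy
    have e : (fun i => ((![(⟨x, hx⟩ : H κ), ⟨y, hy⟩] : Fin 2 → H κ) i).1) = ![x, y] := by
      ext i : 1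
      fin_cases i <;> rfl
    constructor
    · rintro ⟨t, ht, h⟩
      exact (truth_iff prec φ _ _ t rfl (by rw [ht, e])).1 h
    · intro h
      exact ⟨⟨_, ht hx hy⟩, rfl, (truth_iff prec φ _ _ _ rfl (by rw [e])).2 h⟩
  rw [mem_hull prec hx]
  constructor
  · rintro ⟨_, φ, h1, h2⟩
    refine ⟨⟨natSet (godelNumber φ), natSet_mem_H _⟩, (key φ y hy).2 h1, fun y' hy' h => ?_⟩
    exact congrArg Subtype.val (h2 ⟨y', hy'⟩ ((key φ y' hy').1 h))
  · rintro ⟨c, ⟨t, ht', h1⟩, h2⟩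
    have h1' := h1
    obtain ⟨n, φ, z, hc, htz, -⟩ := h1'
    -- The length of the tuple forces the coded formula to have exactly two free variables.
    obtain ⟨e, -⟩ := tuple_eq (htz.symm.trans ht')
    subst e
    have hc' : c = ⟨natSet (godelNumber φ), natSet_mem_H _⟩ := Subtype.ext hc
    rw [hc'] at h1 h2
    exact ⟨hy, φ, (key φ y hy).1 ⟨t, ht', h1⟩, fun y' h => Subtype.ext
      (h2 y' y'.2 ((key φ y' y'.2).2 h))⟩

/-- This is where $\theta$ is needed: it replaces the quantification over defining formulas, which
cannot be made inside $(H(\kappa);\in,\prec^*)$. -/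
theorem defTerm_hull {ι : Type*} [Finite ι] {t : (ι → H κ) → ZFSet.{u}} {A : Set (H κ)}
    (hA : ∀ n, (⟨natSet n, natSet_mem_H n⟩ : H κ) ∈ A)
    (ht : letI := truthStr prec; DefTerm truthLang A t) :
    letI := truthStr prec
    DefTerm truthLang A fun v => hull prec (t v) := by
  let := truthStr prec
  have := memDefinable_truthStr prec
  have htup : ∀ {ι : Type _} [Finite ι] {s t : (ι → H κ) → ZFSet.{u}}, DefTerm truthLang A s →
      DefTerm truthLang A t → DefTerm truthLang A fun v => tuple ![s v, t v] := by
    intro ι _ s t hs ht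
    refine DefTerm.congr ?_ fun v => tuple_pair (s v) (t v)
    exact .pairSet (.pair (.const (natSet_mem_H 0) (hA 0)) hs)
      (.pair (.const (natSet_mem_H 1) (hA 1)) ht)
  refine DefTerm.of_mem_iff (fun _ => hull_mem_H prec _)
    (fun v y hy => mem_hull_iff_truth prec (ht.1 v) hy) ?_
  refine .ex (.and (.ex (.and ?_ (defPred_truth prec _ _ _))) (.allH (.imp (.ex (.and ?_
    (defPred_truth prec _ _ _))) (.eq (.var _) (.var _)))))
  · exact .eq (.var _) (htup (ht.reindex _) (.var _))
  · exact .eq (.var _) (htup (ht.reindex _) (.var _))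

end

/-! ### Closed unbounded sets of countable ordinals -/

theorem cof_omega_one_ne : Order.cof (Iio (ω_ 1 : Ordinal.{u})) ≠ ℵ₀ := by
  rw [Ordinal.cof_Iio]
  simpa using aleph0_lt_aleph_one.ne'

theorem exists_bound {S : Set Ordinal.{u}} (hS : S.Countable) (h : ∀ a ∈ S, a < ω_ 1) :
    ∃ b < (ω_ 1 : Ordinal.{u}), ∀ a ∈ S, a ≤ b := by
  have := hS.to_subtype
  refine ⟨⨆ a : S, a.1, Ordinal.iSup_lt_omega_one fun a => h a a.2, fun a ha => ?_⟩
  exact Ordinal.le_iSup (fun a : S => a.1) ⟨a, ha⟩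

theorem succ_lt_omega_one {α : Ordinal.{u}} (h : α < ω_ 1) : α + 1 < ω_ 1 :=
  (isSuccLimit_omega 1).succ_lt h

theorem two_mul_lt_omega_one {α : Ordinal.{u}} (h : α < ω_ 1) : 2 * α < ω_ 1 := by
  rw [← ord_aleph, lt_ord, Ordinal.card_mul] at *
  exact mul_lt_of_lt (aleph0_le_aleph 1) (by simp) h

/-- The countable ordinals `> α₀` that are closed under a countably-valued function form a club. -/
theorem isClub_closed (R : Ordinal.{u} → Set Ordinal.{u}) (α₀ : Ordinal.{u}) (hα₀ : α₀ < ω_ 1)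
    (hR : ∀ δ < ω_ 1, (R δ).Countable) (hR' : ∀ δ < ω_ 1, ∀ ε ∈ R δ, ε < ω_ 1) :
    IsClub {α : Iio (ω_ 1 : Ordinal.{u}) | α₀ < α.1 ∧ ∀ δ < α.1, ∀ ε ∈ R δ, ε < α.1} := by
  constructor
  · intro d hd hne _ a ha
    refine ⟨?_, fun δ hδ ε hε => ?_⟩
    · obtain ⟨b, hb⟩ := hne
      exact (hd hb).1.trans_le (ha.1 hb)
    · have : ¬ (⟨δ, hδ.trans a.2⟩ : Iio (ω_ 1 : Ordinal.{u})) ∈ upperBounds d := fun h =>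
        (ha.2 h).not_gt hδ
      simp only [upperBounds, mem_ofPred_eq, not_forall, not_le] at this
      obtain ⟨b, hb, hlt⟩ := this
      exact ((hd hb).2 δ hlt ε hε).trans_le (ha.1 hb)
  · intro a
    have step : ∀ β < (ω_ 1 : Ordinal.{u}), ∃ γ < (ω_ 1 : Ordinal.{u}), β < γ ∧
        ∀ δ < β, ∀ ε ∈ R δ, ε < γ := by
      intro β hβ
      obtain ⟨γ, hγ, h⟩ := exists_bound (S := insert β (⋃ δ ∈ Iio β, R δ))
        (((countable_Iio hβ).biUnion fun δ hδ => hR δ (hδ.trans hβ)).insert β) (by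
          rintro ε (rfl | hε)
          · exact hβ
          · simp only [mem_iUnion] at hε
            obtain ⟨δ, hδ, hε⟩ := hε
            exact hR' δ (lt_trans hδ hβ) ε hε)
      refine ⟨γ + 1, succ_lt_omega_one hγ, Order.lt_add_one_iff.2 (h β (mem_insert _ _)),
        fun δ hδ ε hε => Order.lt_add_one_iff.2 (h ε (mem_insert_of_mem _ ?_))⟩
      simp only [mem_iUnion]
      exact ⟨δ, hδ, hε⟩
    choose! g hg1 hg2 hg3 using step
    -- The supremum of countably many closing-off steps above `a` and `α₀` is closed under `R`.
    let s : ℕ → Ordinal.{u} := fun n => g^[n] (max a.1 (α₀ + 1))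
    have hs : ∀ n, s n < ω_ 1 := by
      intro n
      induction n with
      | zero => exact max_lt a.2 (succ_lt_omega_one hα₀)
      | succ n ih =>
        change g^[n+1] _ < _
        rw [Function.iterate_succ_apply']
        exact hg1 _ ih
    have hs' : ∀ n, s (n + 1) = g (s n) := fun n => Function.iterate_succ_apply' _ _ _
    have hle : ∀ n, s n ≤ ⨆ n, s n := Ordinal.le_iSup s
    refine ⟨⟨⨆ n, s n, Ordinal.iSup_lt_omega_one hs⟩, ⟨?_, fun δ hδ ε hε => ?_⟩, ?_⟩
    · exact (Order.lt_add_one_iff.2 le_rfl).trans_le ((le_max_right _ _).trans (hle 0))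
    · obtain ⟨n, hn⟩ := (Ordinal.lt_iSup_iff).1 hδ
      exact (hg3 (s n) (hs n) δ hn ε hε).trans_le ((hs' n).symm.le.trans (hle (n + 1)))
    · change a.1 ≤ ⨆ n, s n
      exact (le_max_left _ _).trans (hle 0)

theorem IsStationary.mono {S S' : Set Ordinal.{u}} (hS : IsStationary S) {C : Set (Iio (ω_ 1 : Ordinal.{u}))}
    (hC : IsClub C) (h : ∀ α ∈ C, α.1 ∈ S → α.1 ∈ S') : IsStationary S' := by
  intro D hD
  obtain ⟨α, hα, hαS⟩ := hS (C ∩ D) (hC.inter cof_omega_one_ne hD)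
  exact ⟨α, hα.2, h α hα.1 hαS⟩

theorem isSuccLimit_of_closed {α α₀ : Ordinal.{u}} (h0 : α₀ < α) (h : ∀ δ < α, δ + 1 < α) :
    Order.IsSuccLimit α := by
  rw [Ordinal.isSuccLimit_iff, Order.isSuccPrelimit_iff_succ_lt]
  exact ⟨(bot_le.trans_lt h0).ne', h⟩

theorem isClub_succClosed : IsClub {α : Iio (ω_ 1 : Ordinal.{u}) |
    0 < α.1 ∧ ∀ δ < α.1, ∀ ε ∈ ({δ + 1} : Set Ordinal.{u}), ε < α.1} :=
  isClub_closed _ 0 (Ordinal.omega_pos 1) (fun _ _ => countable_singleton _)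
    fun δ hδ ε hε => by rw [mem_singleton_iff.1 hε]; exact succ_lt_omega_one hδ

theorem IsStationary.mono_limit {S S' : Set Ordinal.{u}} (hS : IsStationary S)
    (h : ∀ α < ω_ 1, Order.IsSuccLimit α → α ∈ S → α ∈ S') : IsStationary S' :=
  hS.mono isClub_succClosed fun α hα =>
    h α α.2 (isSuccLimit_of_closed hα.1 fun δ hδ => hα.2 δ hδ _ rfl)

/-! ### Even ordinals -/

/-- A limit is $\omega\cdot c$, and $2\cdot\omega=\omega$. Thus in the game the numbering of steps
and the numbering of rounds agree at limits. -/
theorem two_mul_limit {α : Ordinal.{u}} (h : Order.IsSuccLimit α) : 2 * α = α := by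
  obtain ⟨c, rfl⟩ := Ordinal.isSuccPrelimit_iff_omega0_dvd.1 h.isSuccPrelimit
  rw [← mul_assoc, show (2 : Ordinal.{u}) = (2 : ℕ) from rfl,
    Ordinal.natCast_mul_omega0 (by norm_num)]

theorem two_mul_div_two (α : Ordinal.{u}) : 2 * α / 2 = α :=
  Ordinal.mul_div_cancel α two_ne_zero

theorem two_mul_lt_two_mul {α β : Ordinal.{u}} : 2 * α < 2 * β ↔ α < β :=
  mul_lt_mul_iff_right₀ two_pos

/-! ### Pairings of countable ordinals -/

/-- An injective map from pairs of countable ordinals to countable ordinals, with a left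
inverse. -/
structure OrdPairing where
  /-- The pairing. -/
  p : Ordinal.{u} → Ordinal.{u} → Ordinal.{u}
  /-- The first component. -/
  q : Ordinal.{u} → Ordinal.{u}
  /-- The second component. -/
  r : Ordinal.{u} → Ordinal.{u}
  p_lt : ∀ α < ω_ 1, ∀ β < ω_ 1, p α β < ω_ 1
  q_lt : ∀ α < ω_ 1, q α < ω_ 1
  q_p : ∀ α < ω_ 1, ∀ β < ω_ 1, q (p α β) = α
  r_p : ∀ α < ω_ 1, ∀ β < ω_ 1, r (p α β) = β

namespace OrdPairing

theorem nonempty : Nonempty OrdPairing.{u} := by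
  have h : #(Iio (ω_ 1 : Ordinal.{u}) × Iio (ω_ 1 : Ordinal.{u})) = #(Iio (ω_ 1 : Ordinal.{u})) := by
    rw [← mul_def]
    apply Cardinal.mul_eq_self
    rw [Cardinal.mk_Iio_ordinal]
    simp
  obtain ⟨e⟩ := Cardinal.eq.1 h
  classical
  refine ⟨⟨fun a b => if h : a < ω_ 1 ∧ b < ω_ 1 then (e (⟨a, h.1⟩, ⟨b, h.2⟩)).1 else 0,
    fun c => if h : c < ω_ 1 then (e.symm ⟨c, h⟩).1.1 else 0,
    fun c => if h : c < ω_ 1 then (e.symm ⟨c, h⟩).2.1 else 0, ?_, ?_, ?_, ?_⟩⟩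
  · intro a ha b hb
    simp only [ha, hb, and_self, dif_pos]
    exact (e (⟨a, ha⟩, ⟨b, hb⟩)).2
  · intro c hc
    simp only [hc, dif_pos]
    exact (e.symm ⟨c, hc⟩).1.2
  all_goals
    intro a ha b hb
    simp only [ha, hb, and_self, dif_pos]
    have := (e (⟨a, ha⟩, ⟨b, hb⟩)).2
    simp only [mem_Iio] at this
    simp [this]

variable (π : OrdPairing.{u})

/-- Ordinals that are closed under the pairing. -/
structure IsClosed (α : Ordinal.{u}) : Prop where
  lt : α < ω_ 1
  omega_lt : ω < α
  add_one_lt : ∀ a < α, a + 1 < α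
  q_lt : ∀ a < α, π.q a < α
  p_lt : ∀ a < α, ∀ b < α, π.p a b < α

variable {π} in
theorem IsClosed.isSuccLimit {α : Ordinal.{u}} (h : π.IsClosed α) : Order.IsSuccLimit α :=
  isSuccLimit_of_closed h.omega_lt h.add_one_lt

theorem exists_isClub (R : Ordinal.{u} → Set Ordinal.{u}) (hR : ∀ δ < ω_ 1, (R δ).Countable)
    (hR' : ∀ δ < ω_ 1, ∀ ε ∈ R δ, ε < ω_ 1) :
    ∃ C : Set (Iio (ω_ 1 : Ordinal.{u})), IsClub C ∧ ∀ α ∈ C, π.IsClosed α.1 ∧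
      ∀ δ < α.1, ∀ ε ∈ R δ, ε < α.1 := by
  refine ⟨_, isClub_closed (fun δ => R δ ∪ ({δ + 1, π.q δ} ∪
    (fun x : Ordinal.{u} × Ordinal.{u} => π.p x.1 x.2) '' (Iio (δ + 1) ×ˢ Iio (δ + 1)))) ω
    Ordinal.omega0_lt_omega_one ?_ ?_, ?_⟩
  · intro δ hδ
    have := countable_Iio (succ_lt_omega_one hδ)
    exact (hR δ hδ).union ((by simp : Set.Countable _).union ((this.prod this).image _))
  · rintro δ hδ ε (h | (rfl | rfl) | ⟨⟨a, b⟩, ⟨ha, hb⟩, rfl⟩)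
    · exact hR' δ hδ ε h
    · exact succ_lt_omega_one hδ
    · exact π.q_lt δ hδ
    · exact π.p_lt _ (lt_trans ha (succ_lt_omega_one hδ)) _ (lt_trans hb (succ_lt_omega_one hδ))
  · rintro α ⟨h1, h2⟩
    refine ⟨⟨α.2, h1, fun a ha => h2 a ha _ (.inr (.inl (.inl rfl))),
      fun a ha => h2 a ha _ (.inr (.inl (.inr rfl))), fun a ha b hb => ?_⟩,
      fun δ hδ ε hε => h2 δ hδ ε (.inl hε)⟩
    -- Closure under a binary function is reduced to the unary operator `R` by attaching to `δ` all
    -- values at pairs with maximum at most `δ`.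
    refine h2 (max a b) (max_lt ha hb) _ (.inr (.inr ⟨(a, b), ⟨?_, ?_⟩, rfl⟩))
    · exact Order.lt_add_one_iff.2 (le_max_left a b)
    · exact Order.lt_add_one_iff.2 (le_max_right a b)

end OrdPairing

/-! ### Chains of elementary submodels -/

section
variable {κ : Cardinal.{u}} [UncountableRegular κ] {prec : H κ → H κ → Prop}

theorem below_congr {f g : Ordinal.{u} → ZFSet.{u}} {P : Ordinal.{u} → Prop} {α : Ordinal.{u}}
    (h : ∀ β < α, P β → f β = g β) : below f P α = below g P α := by
  ext x
  simp only [mem_below]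
  constructor
  · rintro ⟨β, hβ, hP, rfl⟩
    exact ⟨β, hβ, hP, (h β hβ hP).symm⟩
  · rintro ⟨β, hβ, hP, rfl⟩
    exact ⟨β, hβ, hP, h β hβ hP⟩

/-- The set of earlier models is a countable member of `N β`, hence a subset; so `N α` is a
countable member, hence again a subset. -/
theorem subset_of_below_mem {N : Ordinal.{u} → ZFSet.{u}}
    (hN : ∀ α < ω_ 1, IsCountableElementary prec (N α))
    (hmem : ∀ α < ω_ 1, below N (fun _ => True) α ∈ N α) {α β : Ordinal.{u}} (h : α ≤ β)
    (hβ : β < ω_ 1) : N α ⊆ N β := by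
  rcases h.eq_or_lt with rfl | h
  · exact fun _ h => h
  · have h1 := (hN β hβ).subset_of_countable (hmem β hβ) (countable_below hβ _ _)
    exact (hN β hβ).subset_of_countable (h1 (mem_below.2 ⟨α, h, trivial, rfl⟩))
      (hN α (h.trans hβ)).1

theorem ordinalPred_of_not {α : Ordinal.{u}} (h : ¬ ∃ β, α = β + 1) : α.pred = α :=
  Ordinal.pred_eq_of_isSuccPrelimit <| by
    refine (Order.mem_range_succ_or_isSuccPrelimit α).resolve_left ?_
    rintro ⟨β, rfl⟩
    exact h ⟨β, rfl⟩

theorem ordinalPred_mono {α β : Ordinal.{u}} (h : α ≤ β) : α.pred ≤ β.pred :=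
  Ordinal.pred_succ_gi.gc.monotone_l h

/-- A chain of models as in the elementary diamond, from a sequence of models that contain the
required parameters at the same index. -/
theorem exists_chain {T : Triple.{u}} {s h b N : Ordinal.{u} → ZFSet.{u}}
    (hN : ∀ α < ω_ 1, IsCountableElementary prec (N α))
    (hmem : ∀ α < ω_ 1, ({s α, h α, below N (fun _ => True) α} : ZFSet.{u}) ∈ N α)
    (hstat : IsStationary {α | T.Guesses (N α) (b α)}) :
    ∃ M : Ordinal.{u} → ZFSet.{u},
      (∀ α < (ω_ 1 : Ordinal.{u}), IsCountableElementary prec (M α)) ∧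
      (∀ α β : Ordinal.{u}, α ≤ β → β < ω_ 1 → M α ⊆ M β) ∧
      (∀ α < (ω_ 1 : Ordinal.{u}),
        ({s α, h α, below M (fun _ => True) α} : ZFSet.{u}) ∈ M (α + 1)) ∧
      IsStationary {α | T.Guesses (M (α + 1)) (b α)} := by
  have hbel : ∀ α < ω_ 1, below N (fun _ => True) α ∈ N α := fun α hα =>
    ((hN α hα).of_tripleSet_mem (hmem α hα)).2.2
  have hsub : ∀ {α β : Ordinal.{u}}, α ≤ β → β < ω_ 1 → N α ⊆ N β :=
    fun h hβ => subset_of_below_mem hN hbel h hβ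
  have hlim : ∀ α : Ordinal.{u}, (¬ ∃ β, α = β + 1) →
      below (fun α => N (Ordinal.pred α)) (fun _ => True) α = below N (fun _ => True) α := by
    intro α hα
    ext x
    simp only [mem_below, true_and]
    constructor
    · rintro ⟨β, hβ, rfl⟩
      exact ⟨_, (Ordinal.pred_le_self β).trans_lt hβ, rfl⟩
    · rintro ⟨β, hβ, rfl⟩
      refine ⟨β + 1, lt_of_le_of_ne (Order.add_one_le_of_lt hβ) fun e => hα ⟨β, e.symm⟩, ?_⟩
      rw [Ordinal.pred_add_one]
  -- At `α + 1` the new chain takes the value `N α`, as required. Zero and limits are their own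
  -- predecessors, so there `N` is unchanged and occurs once more at the next index.
  refine ⟨fun α => N (Ordinal.pred α), fun α hα => hN _ ((Ordinal.pred_le_self α).trans_lt hα),
    fun α β h hβ => hsub (ordinalPred_mono h) ((Ordinal.pred_le_self β).trans_lt hβ), fun α hα => ?_, ?_⟩
  · beta_reduce
    rw [Ordinal.pred_add_one]
    obtain ⟨h1, h2, h3⟩ := (hN α hα).of_tripleSet_mem (hmem α hα)
    refine (hN α hα).tripleSet_mem h1 h2 ?_
    -- It remains to find the new set of earlier models in `N α`. It agrees with the old one at zero
    -- and limits `α`. At `α = γ + 1` it is the old set up to `γ` if `γ` is a successor, and the old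
    -- set up to `γ + 1` otherwise, because then `γ` is its own predecessor.
    by_cases hs : ∃ γ, α = γ + 1
    · obtain ⟨γ, rfl⟩ := hs
      have hγ : γ < γ + 1 := Order.lt_add_one_iff.2 le_rfl
      by_cases hs' : ∃ δ, γ = δ + 1
      · have : below (fun α => N (Ordinal.pred α)) (fun _ => True) (γ + 1) = below N (fun _ => True) γ := by
          obtain ⟨δ, rfl⟩ := hs'
          ext x
          simp only [mem_below, true_and]
          constructor
          · rintro ⟨β, hβ, rfl⟩
            refine ⟨_, (ordinalPred_mono (Order.lt_add_one_iff.1 hβ)).trans_lt ?_, rfl⟩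
            rw [Ordinal.pred_add_one]
            exact Order.lt_add_one_iff.2 le_rfl
          · rintro ⟨β, hβ, rfl⟩
            exact ⟨β + 1, Order.lt_add_one_iff.2 (Order.add_one_le_of_lt hβ), by
              rw [Ordinal.pred_add_one]⟩
        rw [this]
        exact hsub hγ.le hα (hbel γ (hγ.trans hα))
      · have : below (fun α => N (Ordinal.pred α)) (fun _ => True) (γ + 1) =
            below N (fun _ => True) (γ + 1) := by
          ext x
          simp only [mem_below, true_and]
          constructor
          · rintro ⟨β, hβ, rfl⟩
            exact ⟨_, (Ordinal.pred_le_self β).trans_lt hβ, rfl⟩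
          · rintro ⟨β, hβ, rfl⟩
            rcases (Order.lt_add_one_iff.1 hβ).eq_or_lt with rfl | hlt
            · exact ⟨β, hβ, by rw [ordinalPred_of_not hs']⟩
            · exact ⟨β + 1, Order.lt_add_one_iff.2 (Order.add_one_le_of_lt hlt), by
                rw [Ordinal.pred_add_one]⟩
        rwa [this]
    · rwa [hlim α hs]
  · simpa only [Ordinal.pred_add_one] using hstat

end

/-! ### Continuous sequences that code continuous increasing unions -/

/-- The continuous sequence whose value at a non-limit ordinal `β` is `{∅, {x β}}`. -/
noncomputable def tagSeq (x : Ordinal.{u} → ZFSet.{u}) (β : Ordinal.{u}) : ZFSet.{u} :=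
  open Classical in
  if Order.IsSuccLimit β then ZFSet.range fun γ : Iio β => tagSeq x γ.1 else {∅, {x β}}
termination_by β
decreasing_by exact γ.2

theorem tagSeq_limit (x : Ordinal.{u} → ZFSet.{u}) {β : Ordinal.{u}} (h : Order.IsSuccLimit β) :
    tagSeq x β = below (tagSeq x) (fun _ => True) β := by
  rw [tagSeq, if_pos h]
  ext z
  simp [mem_below]

theorem tagSeq_of_not (x : Ordinal.{u} → ZFSet.{u}) {β : Ordinal.{u}}
    (h : ¬ Order.IsSuccLimit β) : tagSeq x β = {∅, {x β}} := by
  rw [tagSeq, if_neg h]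

/-- This keeps ∅ out of the values at limits, so that ∅ marks exactly the values at non-limits. -/
theorem tagSeq_ne_empty (x : Ordinal.{u} → ZFSet.{u}) (β : Ordinal.{u}) : tagSeq x β ≠ ∅ := by
  intro h
  by_cases hβ : Order.IsSuccLimit β
  · have : tagSeq x 0 ∈ tagSeq x β := by
      rw [tagSeq_limit x hβ]
      exact mem_below.2 ⟨0, hβ.bot_lt, trivial, rfl⟩
    rw [h] at this
    exact ZFSet.notMem_empty _ this
  · rw [tagSeq_of_not x hβ] at h
    exact (ZFSet.eq_empty _).1 h ∅ (by simp)

theorem tag_mem_tagSeq {x : Ordinal.{u} → ZFSet.{u}} {β : Ordinal.{u}} (h : Order.IsSuccLimit β)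
    {z : ZFSet.{u}} : ({∅, {z}} : ZFSet.{u}) ∈ tagSeq x β ↔
      ∃ γ < β, ¬ Order.IsSuccLimit γ ∧ x γ = z := by
  rw [tagSeq_limit x h]
  simp only [mem_below, true_and]
  refine exists_congr fun γ => and_congr_right fun _ => ?_
  by_cases hγ : Order.IsSuccLimit γ
  · simp only [hγ, not_true, false_and, iff_false]
    intro e
    have : (∅ : ZFSet.{u}) ∈ tagSeq x γ := by rw [e]; simp
    rw [tagSeq_limit x hγ] at this
    obtain ⟨δ, -, -, hδ⟩ := mem_below.1 this
    exact tagSeq_ne_empty x δ hδ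
  · simp only [hγ, not_false_iff, true_and]
    rw [tagSeq_of_not x hγ]
    constructor
    · intro e
      have h1 : ({x γ} : ZFSet.{u}) ∈ ({∅, {z}} : ZFSet.{u}) := by rw [← e]; simp
      rcases ZFSet.mem_pair.1 h1 with h1 | h1
      · exact (ZFSet.notMem_empty (x γ) (by rw [← h1]; simp)).elim
      · exact ZFSet.singleton_injective h1
    · rintro rfl
      rfl

theorem tagSeq_mem_H {κ : Cardinal.{u}} [UncountableRegular κ] {x : Ordinal.{u} → ZFSet.{u}}
    (hx : ∀ β < ω_ 1, x β ∈ H κ) {β : Ordinal.{u}} (hβ : β < ω_ 1) : tagSeq x β ∈ H κ := by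
  induction β using WellFoundedLT.induction with
  | ind β ih =>
    by_cases h : Order.IsSuccLimit β
    · rw [tagSeq_limit x h]
      exact below_mem_H hβ fun γ hγ _ => ih γ hγ (hγ.trans hβ)
    · rw [tagSeq_of_not x h]
      exact pairSet_mem_H empty_mem_H (singleton_mem_H (hx β hβ))

/-- At a limit, `x β` is the union of all `z` whose tagged version belongs to `tagSeq x β`, so it is
definable from that set. At other ordinals `x β` is reached by taking members of finite sets. -/
theorem IsCountableElementary.mem_of_tagSeq_mem {κ : Cardinal.{u}} [UncountableRegular κ]
    {prec : H κ → H κ → Prop} {M : ZFSet.{u}} (hM : IsCountableElementary prec M)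
    {x : Ordinal.{u} → ZFSet.{u}} (hx : ∀ β < ω_ 1, x β ∈ H κ)
    (hmono : ∀ β γ, β ≤ γ → γ < ω_ 1 → x β ⊆ x γ)
    (hcont : ∀ β < ω_ 1, Order.IsSuccLimit β → ∀ z ∈ x β, ∃ γ < β, z ∈ x γ)
    {β : Ordinal.{u}} (hβ : β < ω_ 1) (h : tagSeq x β ∈ M) : x β ∈ M := by
  let := ordStr prec
  have := memDefinable_ordStr prec
  by_cases hl : Order.IsSuccLimit β
  · refine hM.mem_of_defTerm (DefTerm.of_mem_iff
      (Q := fun _ u => ∃ z ∈ H κ, ({∅, {z}} : ZFSet.{u}) ∈ tagSeq x β ∧ u ∈ z)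
      (fun _ => hx β hβ) (fun _ u _ => ?_) ?_)
    · simp only [tag_mem_tagSeq hl]
      constructor
      · intro hu
        obtain ⟨γ, hγ, hu⟩ := hcont β hβ hl u hu
        -- `x γ` is not tagged if `γ` is a limit; the larger set `x (γ + 1)` always is.
        have hγ' : γ + 1 < β := hl.succ_lt hγ
        refine ⟨x (γ + 1), hx _ (hγ'.trans hβ), ⟨γ + 1, hγ', ?_, rfl⟩,
          hmono γ (γ + 1) (Order.lt_add_one_iff.2 le_rfl).le (hγ'.trans hβ) hu⟩
        exact fun h => h.isSuccPrelimit _ (Order.covBy_add_one γ)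
      · rintro ⟨z, -, ⟨γ, hγ, -, rfl⟩, hu⟩
        exact hmono γ β hγ.le hβ hu
    · exact .exH (.and (.mem (.pairSet (hM.defTerm_const (hM.natSet_mem 0) |>.congr
        fun _ => by simp [natSet]) (.singleton (.var _))) (hM.defTerm_const h))
        (.mem (.var _) (.var _)))
  · rw [tagSeq_of_not x hl] at h
    have h1 := hM.subset_of_countable h (by simp) (show {x β} ∈ _ by simp)
    exact hM.subset_of_countable h1 (by simp) (by simp)

/-! ### Images and values of set-theoretic relations -/

/-- The set of all `u` with `(η, u) ∈ W` for some `η ∈ ξ`. -/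
noncomputable def relImage (W ξ : ZFSet.{u}) : ZFSet.{u} :=
  (ZFSet.sUnion (ZFSet.sUnion W)).sep fun u => ∃ η ∈ ξ, ZFSet.pair η u ∈ W

theorem mem_relImage {W ξ z : ZFSet.{u}} : z ∈ relImage W ξ ↔ ∃ η ∈ ξ, ZFSet.pair η z ∈ W := by
  rw [relImage, ZFSet.mem_sep, and_iff_right_iff_imp]
  rintro ⟨η, -, h⟩
  exact ZFSet.mem_sUnion.2 ⟨{η, z}, ZFSet.mem_sUnion.2 ⟨_, h, by simp [ZFSet.pair]⟩, by simp⟩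

/-- The value at `ξ` of the function `W`. -/
noncomputable def relApp (W ξ : ZFSet.{u}) : ZFSet.{u} := ZFSet.sUnion (relImage W {ξ})

theorem mem_relApp {W ξ z : ZFSet.{u}} : z ∈ relApp W ξ ↔ ∃ y, ZFSet.pair ξ y ∈ W ∧ z ∈ y := by
  simp [relApp, mem_relImage]

theorem mem_H_of_subset_transClosure {κ : Cardinal.{u}} {x y : ZFSet.{u}} (hx : x ∈ H κ)
    (h : ∀ z ∈ y, z ∈ transClosure x) : y ∈ H κ := by
  refine (mk_le_mk_of_subset ?_).trans_lt hx
  rw [transClosure_eq]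
  refine union_subset h (iUnion₂_subset fun z hz w hw => ?_)
  exact Relation.TransGen.trans hw (h z hz)

theorem sUnion_mem_H {κ : Cardinal.{u}} {x : ZFSet.{u}} (hx : x ∈ H κ) :
    ZFSet.sUnion x ∈ H κ := by
  refine mem_H_of_subset_transClosure hx fun z hz => ?_
  obtain ⟨y, hy, hz⟩ := ZFSet.mem_sUnion.1 hz
  exact .tail (.single hz) hy

theorem mem_H_of_subset {κ : Cardinal.{u}} {x y : ZFSet.{u}} (hx : x ∈ H κ) (h : y ⊆ x) :
    y ∈ H κ :=
  mem_H_of_subset_transClosure hx fun _ hz => .single (h hz)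

theorem relImage_mem_H {κ : Cardinal.{u}} {W ξ : ZFSet.{u}} (hW : W ∈ H κ) :
    relImage W ξ ∈ H κ :=
  mem_H_of_subset (sUnion_mem_H (sUnion_mem_H hW)) ZFSet.sep_subset

theorem relApp_mem_H {κ : Cardinal.{u}} {W ξ : ZFSet.{u}} (hW : W ∈ H κ) :
    relApp W ξ ∈ H κ :=
  sUnion_mem_H (relImage_mem_H hW)

/-- The set-theoretic function `⟨f β : β < α⟩`. -/
noncomputable def seqSet (f : Ordinal.{u} → ZFSet.{u}) (α : Ordinal.{u}) : ZFSet.{u} :=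
  below (fun β => ZFSet.pair β.toZFSet (f β)) (fun _ => True) α

theorem pair_mem_seqSet {f : Ordinal.{u} → ZFSet.{u}} {α β : Ordinal.{u}} {z : ZFSet.{u}} :
    ZFSet.pair β.toZFSet z ∈ seqSet f α ↔ β < α ∧ z = f β := by
  simp only [seqSet, mem_below, true_and, ZFSet.pair_inj]
  constructor
  · rintro ⟨γ, hγ, h, rfl⟩
    rw [← Ordinal.toZFSet_injective h]
    exact ⟨hγ, rfl⟩
  · rintro ⟨h, rfl⟩
    exact ⟨β, h, rfl, rfl⟩

theorem relApp_seqSet {f : Ordinal.{u} → ZFSet.{u}} {α β : Ordinal.{u}} (h : β < α) :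
    relApp (seqSet f α) β.toZFSet = f β := by
  ext z
  simp [mem_relApp, pair_mem_seqSet, h]

theorem relImage_seqSet {f : Ordinal.{u} → ZFSet.{u}} {α β : Ordinal.{u}} (h : β ≤ α) :
    relImage (seqSet f α) β.toZFSet = below f (fun _ => True) β := by
  ext z
  simp only [mem_relImage, mem_below, Ordinal.mem_toZFSet_iff, true_and]
  constructor
  · rintro ⟨_, ⟨γ, hγ, rfl⟩, h'⟩
    exact ⟨γ, hγ, (pair_mem_seqSet.1 h').2.symm⟩
  · rintro ⟨γ, hγ, rfl⟩
    exact ⟨_, ⟨γ, hγ, rfl⟩, pair_mem_seqSet.2 ⟨hγ.trans_le h, rfl⟩⟩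

section
variable {κ : Cardinal.{u}} [UncountableRegular κ] {L : FirstOrder.Language.{0, 0}}
  [L.Structure (H κ)] {A : Set (H κ)} {ι : Type*} [Finite ι] [MemDefinable κ L]
  {s t : (ι → H κ) → ZFSet.{u}}

theorem seqSet_mem_H {f : Ordinal.{u} → ZFSet.{u}} {α : Ordinal.{u}} (hα : α < ω_ 1)
    (h : ∀ β < α, f β ∈ H κ) : seqSet f α ∈ H κ :=
  below_mem_H hα fun β hβ _ => pair_mem_H (toZFSet_mem_H (hβ.trans hα)) (h β hβ)

theorem DefTerm.relImage (hs : DefTerm L A s) (ht : DefTerm L A t) :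
    DefTerm L A fun v => relImage (s v) (t v) :=
  DefTerm.of_mem_iff (fun v => relImage_mem_H (hs.1 v)) (fun _ _ _ => mem_relImage)
    (.exMem (ht.reindex _) (.mem (.pair (.var _) (.var _)) (hs.reindex fun i => some (some i))))

theorem DefTerm.relApp (hs : DefTerm L A s) (ht : DefTerm L A t) :
    DefTerm L A fun v => relApp (s v) (t v) :=
  DefTerm.of_mem_iff (Q := fun v z => ∃ y ∈ H κ, ZFSet.pair (t v) y ∈ s v ∧ z ∈ y)
    (fun v => relApp_mem_H (hs.1 v)) (fun v z _ => by
      rw [mem_relApp]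
      exact ⟨fun ⟨y, h, h'⟩ => ⟨y, snd_mem_H (H_trans h (hs.1 v)), h, h'⟩,
        fun ⟨y, _, h⟩ => ⟨y, h⟩⟩)
    (.exH (.and (.mem (.pair (ht.reindex fun i => some (some i)) (.var _))
      (hs.reindex fun i => some (some i))) (.mem (.var _) (.var _))))

/-- Substitution of a term for a variable of a term. -/
theorem DefTerm.subst (hs : DefTerm L A s) {g : (ι → H κ) → ZFSet.{u} → ZFSet.{u}}
    (h : DefTerm L A fun w : Option ι → H κ => g (fun i => w (some i)) (w none).1) :
    DefTerm L A fun v => g v (s v) := by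
  refine ⟨fun v => h.1 (fun o => o.elim ⟨s v, hs.1 v⟩ v), ?_⟩
  refine DefPred.subst (hs.reindex some)
    (P := fun (w : Option ι → H κ) z => (w none).1 = g (fun i => w (some i)) z) ?_
  exact h.2.reindex fun o => o.elim (some none) fun o => o.elim none fun i => some (some i)

/-- The set of values of a function that is defined by recursion on ordinals is definable. -/
theorem DefTerm.below_of_rec {w : (ι → H κ) → Ordinal.{u} → ZFSet.{u}} {α : Ordinal.{u}}
    (hα : α < ω_ 1) (hαA : (⟨α.toZFSet, toZFSet_mem_H hα⟩ : H κ) ∈ A)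
    {g : (ι → H κ) → ZFSet.{u} → ZFSet.{u} → ZFSet.{u}}
    (hg : DefTerm L A fun z : Option (Option ι) → H κ =>
      g (fun i => z (some (some i))) (z (some none)).1 (z none).1)
    (hw : ∀ v, ∀ ξ < α, w v ξ = g v ξ.toZFSet (below (w v) (fun _ => True) ξ)) :
    DefTerm L A fun v => below (w v) (fun _ => True) α := by
  have hgH : ∀ v, ∀ x ∈ H κ, ∀ y ∈ H κ, g v x y ∈ H κ := fun v x hx y hy =>
    hg.1 fun o => o.elim ⟨y, hy⟩ fun o => o.elim ⟨x, hx⟩ v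
  have hwH : ∀ v, ∀ ξ < α, w v ξ ∈ H κ := by
    intro v ξ hξ
    induction ξ using WellFoundedLT.induction with
    | ind ξ ih =>
      rw [hw v ξ hξ]
      exact hgH _ _ (toZFSet_mem_H (hξ.trans hα)) _
        (below_mem_H (hξ.trans hα) fun η hη _ => ih η hη (hη.trans hξ))
  -- `Q` says that `W` obeys the recursion at `ξ`. A value of the recursion is a value at some
  -- $\xi<\alpha$ of an approximation `W` obeying it at all ordinals below $\alpha$; what `W`
  -- contains elsewhere does not matter.
  let Q : (ι → H κ) → ZFSet.{u} → ZFSet.{u} → ZFSet.{u} → Prop := fun v W ξ z =>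
    ZFSet.pair ξ z ∈ W ↔ z = g v ξ (GuessingModels.relImage W ξ)
  refine DefTerm.of_mem_iff (Q := fun v u => ∃ W ∈ H κ,
    (∀ ξ ∈ α.toZFSet, ∀ z ∈ H κ, Q v W ξ z) ∧ ∃ ξ ∈ α.toZFSet, ZFSet.pair ξ u ∈ W)
    (fun v => below_mem_H hα fun ξ hξ _ => hwH v ξ hξ) ?_ ?_
  · intro v u hu
    constructor
    · intro h
      refine ⟨seqSet (w v) α, seqSet_mem_H hα (hwH v), ?_, ?_⟩
      · intro ξ hξ z hz
        obtain ⟨ξ, hξ', rfl⟩ := Ordinal.mem_toZFSet_iff.1 hξ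
        simp only [Q]
        rw [relImage_seqSet hξ'.le, pair_mem_seqSet, ← hw v ξ hξ']
        simp [hξ']
      · obtain ⟨ξ, hξ, -, rfl⟩ := mem_below.1 h
        exact ⟨_, Ordinal.toZFSet_mem_toZFSet_iff.2 hξ, pair_mem_seqSet.2 ⟨hξ, rfl⟩⟩
    · rintro ⟨W, hWH, hW, ξ, hξ, h⟩
      have key : ∀ ξ < α, ∀ z, ZFSet.pair ξ.toZFSet z ∈ W ↔ z = w v ξ := by
        intro ξ hξ
        induction ξ using WellFoundedLT.induction with
        | ind ξ ih =>
          have h1 : GuessingModels.relImage W ξ.toZFSet = below (w v) (fun _ => True) ξ := by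
            ext z
            simp only [mem_relImage, Ordinal.mem_toZFSet_iff, mem_below, true_and]
            constructor
            · rintro ⟨_, ⟨η, hη, rfl⟩, h⟩
              exact ⟨η, hη, ((ih η hη (hη.trans hξ) z).1 h).symm⟩
            · rintro ⟨η, hη, rfl⟩
              exact ⟨_, ⟨η, hη, rfl⟩, (ih η hη (hη.trans hξ) _).2 rfl⟩
          have h2 : ∀ z ∈ H κ, ZFSet.pair ξ.toZFSet z ∈ W ↔ z = w v ξ := by
            intro z hz
            rw [hw v ξ hξ, ← h1]
            exact hW _ (Ordinal.toZFSet_mem_toZFSet_iff.2 hξ) z hz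
          intro z
          constructor
          · exact fun h => (h2 z (snd_mem_H (H_trans h hWH))).1 h
          · rintro rfl
            exact (h2 _ (hwH v ξ hξ)).2 rfl
      obtain ⟨ξ, hξ', rfl⟩ := Ordinal.mem_toZFSet_iff.1 hξ
      exact mem_below.2 ⟨ξ, hξ', trivial, ((key ξ hξ' u).1 h).symm⟩
  · have hαt : ∀ {ι' : Type _} [Finite ι'], DefTerm L A fun _ : ι' → H κ => α.toZFSet :=
      fun {_} _ => DefTerm.const _ hαA
    refine .exH (.and (.allMem hαt (.allH (.iff (.mem (.pair (.var _) (.var _)) (.var _))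
      (.eq (.var _) ?_)))) (.exMem hαt (.mem (.pair (.var _) (.var _)) (.var _))))
    have hI : DefTerm L A fun w : Option (Option (Option (Option ι))) → H κ =>
        GuessingModels.relImage (w (some (some none))).1 (w (some none)).1 :=
      .relImage (.var _) (.var _)
    refine DefTerm.subst hI (g := fun w x =>
      g (fun i => w (some (some (some (some i))))) (w (some none)).1 x) ?_
    exact hg.reindex fun o => o.elim none fun o => o.elim (some (some none))
      fun i => some (some (some (some (some i))))

end

namespace OrdPairing

/-! ### Coding sequences of hereditarily countable sets by sets of countable ordinals -/

variable (π : OrdPairing.{u})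

/-- The restriction of the pairing to `α`. -/
noncomputable def graph (α : Ordinal.{u}) : ZFSet.{u} :=
  ZFSet.range fun x : Iio α × Iio α =>
    ZFSet.pair x.1.1.toZFSet (ZFSet.pair x.2.1.toZFSet (π.p x.1.1 x.2.1).toZFSet)

theorem mem_graph {α : Ordinal.{u}} {x y z : ZFSet.{u}} :
    ZFSet.pair x (ZFSet.pair y z) ∈ π.graph α ↔
      ∃ a < α, ∃ b < α, x = a.toZFSet ∧ y = b.toZFSet ∧ z = (π.p a b).toZFSet := by
  simp only [graph, ZFSet.mem_range, Prod.exists, Subtype.exists, mem_Iio, ZFSet.pair_inj,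
    exists_prop]
  refine exists_congr fun a => and_congr_right fun _ => exists_congr fun b =>
    and_congr_right fun _ => ?_
  simp only [eq_comm]

theorem mem_graph' {α a b : Ordinal.{u}} {z : ZFSet.{u}} :
    ZFSet.pair a.toZFSet (ZFSet.pair b.toZFSet z) ∈ π.graph α ↔
      a < α ∧ b < α ∧ z = (π.p a b).toZFSet := by
  rw [mem_graph]
  constructor
  · rintro ⟨a', ha, b', hb, h1, h2, rfl⟩
    obtain rfl := Ordinal.toZFSet_injective h1
    obtain rfl := Ordinal.toZFSet_injective h2
    exact ⟨ha, hb, rfl⟩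
  · rintro ⟨ha, hb, rfl⟩
    exact ⟨a, ha, b, hb, rfl, rfl, rfl⟩

theorem countable_graph {α : Ordinal.{u}} (hα : α < ω_ 1) :
    (π.graph α : Set ZFSet.{u}).Countable := by
  have := (countable_Iio hα).to_subtype
  rw [graph, ZFSet.coe_range]
  exact countable_range _

theorem graph_mem_H {κ : Cardinal.{u}} [UncountableRegular κ] {α : Ordinal.{u}} (hα : α < ω_ 1) :
    π.graph α ∈ H κ := by
  refine mem_H_of_countable (π.countable_graph hα) fun y hy => ?_
  obtain ⟨⟨⟨a, ha⟩, ⟨b, hb⟩⟩, rfl⟩ := ZFSet.mem_range.1 hy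
  have ha' := lt_trans ha hα
  have hb' := lt_trans hb hα
  exact pair_mem_H (toZFSet_mem_H ha') (pair_mem_H (toZFSet_mem_H hb')
    (toZFSet_mem_H (π.p_lt _ ha' _ hb')))

/-- `e` is a function with domain `α` such that `e δ = {e ε | ε < α, p ε δ ∈ X}` for all
`δ < α`. -/
def IsDecoding (α : Ordinal.{u}) (X e : ZFSet.{u}) : Prop :=
  (∀ δ ∈ α.toZFSet, ∃ z, ZFSet.pair δ z ∈ e) ∧
    ∀ δ ∈ α.toZFSet, ∀ z, ZFSet.pair δ z ∈ e → ∀ u, u ∈ z ↔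
      ∃ ε ∈ α.toZFSet, (∃ ζ ∈ X, ZFSet.pair ε (ZFSet.pair δ ζ) ∈ π.graph α) ∧ ZFSet.pair ε u ∈ e

variable {π} in
-- The set `X` decides which indices contribute members to a value, so two decodings agree by
-- ∈-induction on the value. No well-foundedness of the coded relation has to be assumed.
theorem IsDecoding.unique {α : Ordinal.{u}} {X e e' : ZFSet.{u}} (h : π.IsDecoding α X e)
    (h' : π.IsDecoding α X e') {δ z z' : ZFSet.{u}} (hδ : δ ∈ α.toZFSet)
    (hz : ZFSet.pair δ z ∈ e) (hz' : ZFSet.pair δ z' ∈ e') : z = z' := by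
  induction z using ZFSet.inductionOn generalizing δ z' with
  | h z ih =>
    ext u
    constructor
    · intro hu
      obtain ⟨ε, hε, hX, hεe⟩ := (h.2 δ hδ z hz u).1 hu
      obtain ⟨u', hu'⟩ := h'.1 ε hε
      obtain rfl := ih u hu hε hεe hu'
      exact (h'.2 δ hδ z' hz' u).2 ⟨ε, hε, hX, hu'⟩
    · intro hu
      obtain ⟨ε, hε, hX, hεe'⟩ := (h'.2 δ hδ z' hz' u).1 hu
      obtain ⟨u', hu'⟩ := h.1 ε hε
      have hu'z := (h.2 δ hδ z hz u').2 ⟨ε, hε, hX, hu'⟩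
      obtain rfl := ih u' hu'z hε hu' hεe'
      exact hu'z

/-- `x` is the value at `p β 0` of the function coded by `X`. -/
def Decodes (κ : Cardinal.{u}) (α : Ordinal.{u}) (X β x : ZFSet.{u}) : Prop :=
  ∃ e ∈ H κ, π.IsDecoding α X e ∧
    ∃ ζ ∈ α.toZFSet, ZFSet.pair β (ZFSet.pair ∅ ζ) ∈ π.graph α ∧ ZFSet.pair ζ x ∈ e

variable {π} in
theorem Decodes.unique {κ : Cardinal.{u}} {α : Ordinal.{u}} {X β x y : ZFSet.{u}}
    (hx : π.Decodes κ α X β x) (hy : π.Decodes κ α X β y) : x = y := by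
  obtain ⟨e, -, he, ζ, hζ, h1, h2⟩ := hx
  obtain ⟨e', -, he', ζ', hζ', h1', h2'⟩ := hy
  have : ζ = ζ' := by
    obtain ⟨a, ha, b, hb, rfl, h0, rfl⟩ := π.mem_graph.1 h1
    rw [h0] at h1'
    exact ((π.mem_graph').1 h1').2.2.symm
  subst this
  exact he.unique he' hζ h2 h2'

/-- The value at `p β 0` of the function coded by `X`. -/
noncomputable def decode (κ : Cardinal.{u}) (α : Ordinal.{u}) (X β : ZFSet.{u}) : ZFSet.{u} :=
  open Classical in if h : ∃ x, π.Decodes κ α X β x then h.choose else ∅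

variable {π} in
theorem Decodes.decode_eq {κ : Cardinal.{u}} {α : Ordinal.{u}} {X β x : ZFSet.{u}}
    (h : π.Decodes κ α X β x) : π.decode κ α X β = x := by
  have h' : ∃ x, π.Decodes κ α X β x := ⟨x, h⟩
  rw [decode, dif_pos h']
  exact h'.choose_spec.unique h

theorem mem_decode {κ : Cardinal.{u}} {α : Ordinal.{u}} {X β z : ZFSet.{u}} :
    z ∈ π.decode κ α X β ↔ ∃ x, π.Decodes κ α X β x ∧ z ∈ x := by
  by_cases h : ∃ x, π.Decodes κ α X β x
  · obtain ⟨x, hx⟩ := h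
    rw [hx.decode_eq]
    exact ⟨fun h => ⟨x, hx, h⟩, fun ⟨y, hy, h⟩ => by rwa [hx.unique hy]⟩
  · rw [decode, dif_neg h]
    simp only [ZFSet.notMem_empty, false_iff]
    exact fun ⟨x, hx, _⟩ => h ⟨x, hx⟩

theorem Decodes.mem_H {π : OrdPairing.{u}} {κ : Cardinal.{u}} {α : Ordinal.{u}} {X β x : ZFSet.{u}}
    (h : π.Decodes κ α X β x) : x ∈ H κ := by
  obtain ⟨e, he, -, ζ, -, -, h⟩ := h
  exact snd_mem_H (H_trans h he)

theorem decode_mem_H {κ : Cardinal.{u}} [UncountableRegular κ] {α : Ordinal.{u}}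
    {X β : ZFSet.{u}} : π.decode κ α X β ∈ H κ := by
  by_cases h : ∃ x, π.Decodes κ α X β x
  · obtain ⟨x, hx⟩ := h
    rw [hx.decode_eq]
    exact hx.mem_H
  · rw [decode, dif_neg h]
    exact empty_mem_H

/-- All sets mentioned in `IsDecoding` are second coordinates of pairs in `e`, hence in $H(\kappa)$,
so its quantifiers can be relativized. Only `α`, ∅ and the pairing on `α` are needed as parameters,
which lets a model containing these decode. -/
theorem defTerm_decode {κ : Cardinal.{u}} [UncountableRegular κ]
    {L : FirstOrder.Language.{0, 0}} [L.Structure (H κ)] {A : Set (H κ)} {ι : Type*} [Finite ι]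
    [MemDefinable κ L] {s t : (ι → H κ) → ZFSet.{u}} {α : Ordinal.{u}} (hα : α < ω_ 1)
    (hαA : (⟨α.toZFSet, toZFSet_mem_H hα⟩ : H κ) ∈ A) (h0A : (⟨∅, empty_mem_H⟩ : H κ) ∈ A)
    (hPA : (⟨π.graph α, π.graph_mem_H hα⟩ : H κ) ∈ A)
    (hs : DefTerm L A s) (ht : DefTerm L A t) :
    DefTerm L A fun v => π.decode κ α (s v) (t v) := by
  have hαt : ∀ {ι' : Type _} [Finite ι'], DefTerm L A fun _ : ι' → H κ => α.toZFSet :=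
    fun {_} _ => DefTerm.const _ hαA
  have h0t : ∀ {ι' : Type _} [Finite ι'], DefTerm L A fun _ : ι' → H κ => (∅ : ZFSet.{u}) :=
    fun {_} _ => DefTerm.const _ h0A
  have hPt : ∀ {ι' : Type _} [Finite ι'], DefTerm L A fun _ : ι' → H κ => π.graph α :=
    fun {_} _ => DefTerm.const _ hPA
  refine DefTerm.of_mem_iff (Q := fun v u => ∃ x ∈ H κ, (∃ e ∈ H κ,
    ((∀ δ ∈ α.toZFSet, ∃ z ∈ H κ, ZFSet.pair δ z ∈ e) ∧
      ∀ δ ∈ α.toZFSet, ∀ z ∈ H κ, ZFSet.pair δ z ∈ e → ∀ u ∈ H κ, u ∈ z ↔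
        ∃ ε ∈ α.toZFSet, (∃ ζ ∈ s v, ZFSet.pair ε (ZFSet.pair δ ζ) ∈ π.graph α) ∧
          ZFSet.pair ε u ∈ e) ∧
    ∃ ζ ∈ α.toZFSet, ZFSet.pair (t v) (ZFSet.pair ∅ ζ) ∈ π.graph α ∧ ZFSet.pair ζ x ∈ e) ∧ u ∈ x)
    (fun v => π.decode_mem_H) (fun v u _ => ?_) ?_
  · have key : ∀ e ∈ H κ, π.IsDecoding α (s v) e ↔
        ((∀ δ ∈ α.toZFSet, ∃ z ∈ H κ, ZFSet.pair δ z ∈ e) ∧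
        ∀ δ ∈ α.toZFSet, ∀ z ∈ H κ, ZFSet.pair δ z ∈ e → ∀ u ∈ H κ, u ∈ z ↔
        ∃ ε ∈ α.toZFSet, (∃ ζ ∈ s v, ZFSet.pair ε (ZFSet.pair δ ζ) ∈ π.graph α) ∧
          ZFSet.pair ε u ∈ e) := by
      intro e he
      have hsnd : ∀ {x y}, ZFSet.pair x y ∈ e → y ∈ H κ := fun h => snd_mem_H (H_trans h he)
      constructor
      · rintro ⟨h1, h2⟩
        refine ⟨fun δ hδ => ?_, fun δ hδ z _ h u _ => h2 δ hδ z h u⟩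
        obtain ⟨z, hz⟩ := h1 δ hδ
        exact ⟨z, hsnd hz, hz⟩
      · rintro ⟨h1, h2⟩
        refine ⟨fun δ hδ => ?_, fun δ hδ z h u => ?_⟩
        · obtain ⟨z, -, hz⟩ := h1 δ hδ
          exact ⟨z, hz⟩
        · constructor
          · exact fun hu => (h2 δ hδ z (hsnd h) h u (H_trans hu (hsnd h))).1 hu
          · rintro ⟨ε, hε, hX, hεe⟩
            exact (h2 δ hδ z (hsnd h) h u (hsnd hεe)).2 ⟨ε, hε, hX, hεe⟩
    rw [mem_decode]
    refine exists_congr fun x => ?_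
    constructor
    · rintro ⟨hx, hu⟩
      refine ⟨hx.mem_H, ?_, hu⟩
      obtain ⟨e, he, hd, h⟩ := hx
      exact ⟨e, he, (key e he).1 hd, h⟩
    · rintro ⟨-, ⟨e, he, hd, h⟩, hu⟩
      exact ⟨⟨e, he, (key e he).2 hd, h⟩, hu⟩
  · refine .exH (.and (.exH (.and (.and ?_ ?_) ?_)) (.mem (.var _) (.var _)))
    · exact .allMem hαt (.exH (.mem (.pair (.var _) (.var _)) (.var _)))
    · refine .allMem hαt (.allH (.imp (.mem (.pair (.var _) (.var _)) (.var _)) (.allH (.iff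
        (.mem (.var _) (.var _)) (.exMem hαt (.and (.exMem ?_ (.mem (.pair (.var _)
        (.pair (.var _) (.var _))) hPt)) (.mem (.pair (.var _) (.var _)) (.var _))))))))
      exact hs.reindex fun i => some (some (some (some (some (some (some i))))))
    · refine .exMem hαt (.and (.mem (.pair ?_ (.pair h0t (.var _))) hPt)
        (.mem (.pair (.var _) (.var _)) (.var _)))
      exact ht.reindex fun i => some (some (some (some i)))

/-- `E` lists the countable set consisting of `x` and its transitive closure. Index `0` is kept for
`x`, the list starts at index `1`, and all other indices carry ∅, which has no members to account
for. -/
theorem exists_enumeration {x : ZFSet.{u}} (hx : x ∈ H ℵ₁) : ∃ E : Ordinal.{u} → ZFSet.{u},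
    E 0 = x ∧ (∀ ρ, E ρ ∈ H ℵ₁) ∧ ∀ ρ, ∀ y ∈ E ρ, ∃ σ < ω, E σ = y := by
  have hc : (insert x (transClosure x)).Countable := (countable_transClosure hx).insert x
  obtain ⟨f, hf⟩ := hc.exists_eq_range ⟨x, mem_insert _ _⟩
  have hfin : ∀ y ∈ insert x (transClosure x), ∀ z ∈ y, z ∈ insert x (transClosure x) := by
    rintro y (rfl | hy) z hz
    · exact .inr (.single hz)
    · exact .inr (Relation.TransGen.head hz hy)
  have hH : ∀ y ∈ insert x (transClosure x), y ∈ H ℵ₁ := by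
    rintro y (rfl | hy)
    · exact hx
    · exact Relation.TransGen.head_induction_on hy (fun h => H_trans h hx)
        (fun h _ h' => H_trans h h')
  classical
  refine ⟨fun ρ => if ρ = 0 then x else if h : ∃ n : ℕ, ρ = n + 1 then f h.choose else ∅,
    by simp, fun ρ => ?_, fun ρ y hy => ?_⟩
  · dsimp only
    split_ifs with h0 h
    · exact hx
    · exact hH _ (by rw [hf]; exact ⟨_, rfl⟩)
    · exact empty_mem_H
  · have : y ∈ insert x (transClosure x) := by
      dsimp only at hy
      split_ifs at hy with h0 h
      · exact hfin x (mem_insert _ _) y hy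
      · exact hfin _ (by rw [hf]; exact ⟨_, rfl⟩) y hy
      · exact (ZFSet.notMem_empty _ hy).elim
    rw [hf] at this
    obtain ⟨n, rfl⟩ := this
    have h : ∃ m : ℕ, ((n + 1 : ℕ) : Ordinal.{u}) = m + 1 := ⟨n, by push_cast; rfl⟩
    refine ⟨(n + 1 : ℕ), Ordinal.natCast_lt_omega0 _, ?_⟩
    have h2 : h.choose = n := by
      have := h.choose_spec
      exact_mod_cast (Nat.succ_injective (by exact_mod_cast this)).symm
    dsimp only
    rw [if_neg (by exact_mod_cast Nat.succ_ne_zero n), dif_pos h, h2]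

/-- Every sequence of hereditarily countable sets is coded by a set of countable ordinals. -/
theorem exists_code {s : Ordinal.{u} → ZFSet.{u}} (hs : ∀ β < ω_ 1, s β ∈ H ℵ₁) :
    ∃ X ⊆ (ω_ 1 : Ordinal.{u}).toZFSet, ∀ (κ : Cardinal.{u}) [UncountableRegular κ] (α),
      π.IsClosed α → ∀ β < α, π.decode κ α (X ∩ α.toZFSet) β.toZFSet = s β := by
  have hE : ∀ β, ∃ E : Ordinal.{u} → ZFSet.{u}, β < ω_ 1 →
      E 0 = s β ∧ (∀ ρ, E ρ ∈ H ℵ₁) ∧ ∀ ρ, ∀ y ∈ E ρ, ∃ σ < ω, E σ = y := by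
    intro β
    by_cases hβ : β < ω_ 1
    · obtain ⟨E, h⟩ := exists_enumeration (hs β hβ)
      exact ⟨E, fun _ => h⟩
    · exact ⟨fun _ => ∅, fun h => (hβ h).elim⟩
  choose E hE using hE
  -- The index `p β ρ` stands for the `ρ`-th set in the list for `s β`, and `X` records the
  -- membership relation between indices. For closed `α`, the restriction of `e` to `α` is then the
  -- decoding of `X ∩ α`.
  let e : Ordinal.{u} → ZFSet.{u} := fun δ => E (π.q δ) (π.r δ)
  have hep : ∀ a < ω_ 1, ∀ b < ω_ 1, e (π.p a b) = E a b := fun a ha b hb => by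
    simp only [e, π.q_p a ha b hb, π.r_p a ha b hb]
  let X : ZFSet.{u} := (ω_ 1 : Ordinal.{u}).toZFSet.sep fun z =>
    ∃ ε < ω_ 1, ∃ δ < ω_ 1, z = (π.p ε δ).toZFSet ∧ e ε ∈ e δ
  have hX : ∀ ε < ω_ 1, ∀ δ < ω_ 1, (π.p ε δ).toZFSet ∈ X ↔ e ε ∈ e δ := by
    intro ε hε δ hδ
    rw [ZFSet.mem_sep, and_iff_right (Ordinal.toZFSet_mem_toZFSet_iff.2 (π.p_lt ε hε δ hδ))]
    constructor
    · rintro ⟨ε', hε', δ', hδ', h, h'⟩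
      have h := Ordinal.toZFSet_injective h
      have h1 := π.q_p ε hε δ hδ
      have h2 := π.r_p ε hε δ hδ
      rw [h, π.q_p ε' hε' δ' hδ'] at h1
      rw [h, π.r_p ε' hε' δ' hδ'] at h2
      rwa [← h1, ← h2]
    · exact fun h => ⟨ε, hε, δ, hδ, rfl, h⟩
  refine ⟨X, ZFSet.sep_subset, fun κ _ α hα β hβ => Decodes.decode_eq ?_⟩
  have hlt : ∀ {β}, β < α → β < ω_ 1 := fun h => h.trans hα.lt
  have h0 : (0 : Ordinal.{u}) < α := Ordinal.omega0_pos.trans hα.omega_lt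
  refine ⟨seqSet e α, seqSet_mem_H hα.lt fun δ hδ =>
    H_aleph_one_subset κ ((hE _ (π.q_lt δ (hlt hδ))).2.1 _), ⟨fun δ hδ => ?_, fun δ hδ z hz u => ?_⟩,
    (π.p β 0).toZFSet, Ordinal.toZFSet_mem_toZFSet_iff.2 (hα.p_lt β hβ 0 h0), ?_, ?_⟩
  · obtain ⟨δ, hδ', rfl⟩ := Ordinal.mem_toZFSet_iff.1 hδ
    exact ⟨e δ, pair_mem_seqSet.2 ⟨hδ', rfl⟩⟩
  · obtain ⟨δ, hδ', rfl⟩ := Ordinal.mem_toZFSet_iff.1 hδ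
    obtain ⟨-, rfl⟩ := pair_mem_seqSet.1 hz
    constructor
    · intro hu
      -- Each member of `e δ` occurs in the same list at some index `σ < ω`, that is, as the value
      -- of `e` at `p (q δ) σ`. This lies below `α`, as `α` exceeds `ω` and is closed under `q` and
      -- `p`.
      obtain ⟨σ, hσ, rfl⟩ := (hE _ (π.q_lt δ (hlt hδ'))).2.2 _ u hu
      have hq := hα.q_lt δ hδ'
      have hσ' := hσ.trans hα.omega_lt
      have hε := hα.p_lt _ hq σ hσ'
      have heq := hep _ (hlt hq) σ (hlt hσ')
      refine ⟨(π.p (π.q δ) σ).toZFSet, Ordinal.toZFSet_mem_toZFSet_iff.2 hε,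
        ⟨(π.p (π.p (π.q δ) σ) δ).toZFSet, ?_, π.mem_graph'.2 ⟨hε, hδ', rfl⟩⟩,
        pair_mem_seqSet.2 ⟨hε, heq.symm⟩⟩
      rw [ZFSet.mem_inter]
      exact ⟨(hX _ (hlt hε) δ (hlt hδ')).2 (by rwa [heq]),
        Ordinal.toZFSet_mem_toZFSet_iff.2 (hα.p_lt _ hε _ hδ')⟩
    · rintro ⟨ε, hε, ⟨ζ, hζ, hg⟩, hεu⟩
      obtain ⟨ε, hε', rfl⟩ := Ordinal.mem_toZFSet_iff.1 hε
      obtain ⟨-, rfl⟩ := pair_mem_seqSet.1 hεu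
      obtain ⟨-, -, rfl⟩ := π.mem_graph'.1 hg
      exact (hX ε (hlt hε') δ (hlt hδ')).1 (ZFSet.mem_inter.1 hζ).1
  · rw [← Ordinal.toZFSet_zero, π.mem_graph']
    exact ⟨hβ, h0, rfl⟩
  · refine pair_mem_seqSet.2 ⟨hα.p_lt β hβ 0 h0, ?_⟩
    rw [hep β (hlt hβ) 0 (hlt h0), (hE β (hlt hβ)).1]

end OrdPairing

section
variable {κ : Cardinal.{u}} [UncountableRegular κ] {prec : H κ → H κ → Prop} {T : Triple.{u}}

/-! ### From the strategic to the elementary diamond -/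

theorem below_isOdd_two_mul (M : Ordinal.{u} → ZFSet.{u}) (ξ : Ordinal.{u}) :
    below M IsOdd (2 * ξ) = below (fun η => M (2 * η + 1)) (fun _ => True) ξ := by
  ext x
  simp only [mem_below, true_and]
  constructor
  · rintro ⟨_, hβ, ⟨η, rfl⟩, rfl⟩
    exact ⟨η, two_mul_lt_two_mul.1 (lt_of_le_of_lt le_self_add hβ), rfl⟩
  · rintro ⟨η, hη, rfl⟩
    refine ⟨2 * η + 1, ?_, ⟨η, rfl⟩, rfl⟩
    calc 2 * η + 1 < 2 * η + 2 := by
          rw [← one_add_one_eq_two, ← add_assoc]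
          exact Order.lt_add_one_iff.2 le_rfl
      _ = 2 * (η + 1) := by rw [mul_add, mul_one]
      _ ≤ 2 * ξ := by gcongr; exact Order.add_one_le_of_lt hη

theorem below_isEven_limit (t : Ordinal.{u} → ZFSet.{u}) {α : Ordinal.{u}}
    (hα : Order.IsSuccLimit α) :
    below t IsEven α = below (fun ξ => t (2 * ξ)) (fun _ => True) α := by
  ext x
  simp only [mem_below, true_and]
  constructor
  · rintro ⟨_, hβ, ⟨η, rfl⟩, rfl⟩
    rw [← two_mul_limit hα] at hβ
    exact ⟨η, two_mul_lt_two_mul.1 hβ, rfl⟩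
  · rintro ⟨η, hη, rfl⟩
    refine ⟨2 * η, ?_, ⟨η, rfl⟩, rfl⟩
    rw [← two_mul_limit hα]
    exact two_mul_lt_two_mul.2 hη

theorem div_two_of_limit {α : Ordinal.{u}} (hα : Order.IsSuccLimit α) : α / 2 = α := by
  conv_lhs => rw [← two_mul_limit hα]
  exact two_mul_div_two α

theorem div_two_le (α : Ordinal.{u}) : α / 2 ≤ α :=
  Ordinal.div_le_of_le_mul (Ordinal.le_mul_right α two_pos)

theorem trace_mem_H {κ : Cardinal.{u}} [UncountableRegular κ] (X : ZFSet.{u}) {α : Ordinal.{u}}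
    (hα : α < ω_ 1) : X ∩ α.toZFSet ∈ H κ :=
  mem_H_of_subset (toZFSet_mem_H hα) fun _ hz => (ZFSet.mem_inter.1 hz).2

/-- BAD plays the tagged traces of `X`, one per round. The parameters of the game are indexed by
steps, hence `h (α / 2)`; the guesses need no reindexing, since stationarity concerns only limits,
where `2 * α = α`. -/
theorem StrategicDiamond.elementaryDiamond (hS : StrategicDiamond T prec) :
    ElementaryDiamond T prec IsTraceSeq := by
  intro h hh
  obtain ⟨b, hb, σ, -, hwin⟩ := hS (fun α => h (α / 2)) fun α hα =>
    hh _ ((div_two_le α).trans_lt hα)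
  refine ⟨b, hb, fun s hs => ?_⟩
  obtain ⟨X, -, hs⟩ := hs
  let x : Ordinal.{u} → ZFSet.{u} := fun β => X ∩ β.toZFSet
  let t : Ordinal.{u} → ZFSet.{u} := fun α => tagSeq x (α / 2)
  have ht : ∀ ξ, t (2 * ξ) = tagSeq x ξ := fun ξ => by simp only [t, two_mul_div_two]
  have hbad : IsBadRun t := by
    refine ⟨fun α hα _ => tagSeq_mem_H (fun β hβ => trace_mem_H X hβ)
      ((div_two_le α).trans_lt hα), fun α _ hlim => ?_⟩
    rw [below_isEven_limit t hlim]
    simp only [ht]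
    simp only [t, div_two_of_limit hlim]
    exact tagSeq_limit x hlim
  obtain ⟨hmoves, hstat⟩ := hwin t hbad
  let N : Ordinal.{u} → ZFSet.{u} := fun ξ => σ (2 * ξ + 1) t
  have hN : ∀ ξ < ω_ 1, IsCountableElementary prec (N ξ) := fun ξ hξ =>
    (hmoves _ (two_mul_lt_omega_one hξ) ⟨ξ, rfl⟩).1
  refine exists_chain hN (fun ξ hξ => ?_) (hstat.mono_limit fun α _ hlim hα => ?_)
  · have h1 := (hmoves _ (two_mul_lt_omega_one hξ) ⟨ξ, rfl⟩).2
    beta_reduce at h1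
    rw [below_isOdd_two_mul, two_mul_div_two, ht] at h1
    obtain ⟨h1, h2, h3⟩ := (hN ξ hξ).of_tripleSet_mem h1
    refine (hN ξ hξ).tripleSet_mem ?_ h2 h3
    rw [hs ξ hξ]
    refine (hN ξ hξ).mem_of_tagSeq_mem (x := x) (fun β hβ => trace_mem_H X hβ)
      (fun β γ hβγ _ z hz => ?_) (fun β _ hlim z hz => ?_) hξ h1
    · obtain ⟨hz, hz'⟩ := ZFSet.mem_inter.1 hz
      exact ZFSet.mem_inter.2 ⟨hz, Ordinal.toZFSet_subset_toZFSet_iff.2 hβγ hz'⟩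
    · obtain ⟨hz, hz'⟩ := ZFSet.mem_inter.1 hz
      obtain ⟨γ, hγ, rfl⟩ := Ordinal.mem_toZFSet_iff.1 hz'
      exact ⟨γ + 1, hlim.succ_lt hγ, ZFSet.mem_inter.2 ⟨hz,
        Ordinal.toZFSet_mem_toZFSet_iff.2 (Order.lt_add_one_iff.2 le_rfl)⟩⟩
  · have := hα.2
    simp only [N]
    rw [mem_ofPred_eq, two_mul_limit hlim]
    exact this

/-! ### From the elementary diamond to the weak diamond -/

theorem mem_restrict {f z : ZFSet.{u}} {α : Ordinal.{u}} :
    z ∈ restrict f α ↔ z ∈ f ∧ ∃ ξ < α, ∃ y, z = ZFSet.pair ξ.toZFSet y := by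
  rw [restrict, ZFSet.mem_sep]
  refine and_congr_right fun _ => ⟨?_, ?_⟩
  · rintro ⟨x, hx, y, rfl⟩
    obtain ⟨ξ, hξ, rfl⟩ := Ordinal.mem_toZFSet_iff.1 hx
    exact ⟨ξ, hξ, y, rfl⟩
  · rintro ⟨ξ, hξ, y, rfl⟩
    exact ⟨_, Ordinal.toZFSet_mem_toZFSet_iff.2 hξ, y, rfl⟩

theorem restrict_mem_binSeq {f : ZFSet.{u}} {α β : Ordinal.{u}} (hf : f ∈ binSeq β) (h : α ≤ β) :
    restrict f α ∈ binSeq α := by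
  obtain ⟨h1, h2⟩ := ZFSet.mem_funs.1 hf
  refine ZFSet.mem_funs.2 ⟨fun z hz => ?_, fun x hx => ?_⟩
  · obtain ⟨hz, ξ, hξ, y, rfl⟩ := mem_restrict.1 hz
    exact ZFSet.pair_mem_prod.2 ⟨Ordinal.toZFSet_mem_toZFSet_iff.2 hξ,
      (ZFSet.pair_mem_prod.1 (h1 hz)).2⟩
  · obtain ⟨y, hy, hy'⟩ := h2 x (Ordinal.toZFSet_subset_toZFSet_iff.2 h hx)
    obtain ⟨ξ, hξ, rfl⟩ := Ordinal.mem_toZFSet_iff.1 hx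
    exact ⟨y, mem_restrict.2 ⟨hy, ξ, hξ, y, rfl⟩, fun y' h' => hy' y' (mem_restrict.1 h').1⟩

theorem mem_H_of_mem_binSeq {κ : Cardinal.{u}} [UncountableRegular κ] {f : ZFSet.{u}}
    {α : Ordinal.{u}} (hα : α < ω_ 1) (hf : f ∈ binSeq α) : f ∈ H κ := by
  obtain ⟨h1, -⟩ := ZFSet.mem_funs.1 hf
  have h2 : (natSet.{u} 2 : Set ZFSet.{u}).Countable :=
    countable_toZFSet ((Ordinal.natCast_lt_omega0 2).trans Ordinal.omega0_lt_omega_one)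
  refine mem_H_of_countable ((((countable_toZFSet hα).prod h2).image
    fun x => ZFSet.pair x.1 x.2).mono fun z hz => ?_) fun z hz => ?_
  · obtain ⟨a, ha, b, hb, rfl⟩ := ZFSet.mem_prod.1 (h1 hz)
    exact ⟨(a, b), ⟨ha, hb⟩, rfl⟩
  · obtain ⟨a, ha, b, hb, rfl⟩ := ZFSet.mem_prod.1 (h1 hz)
    exact pair_mem_H (H_trans ha (toZFSet_mem_H hα)) (H_trans hb (natSet_mem_H 2))

theorem Triple.mem_countableSubsets_A {a : ZFSet.{u}} :
    a ∈ T.countableSubsets.A ↔ a ⊆ T.A ∧ (a : Set ZFSet.{u}).Countable := by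
  rw [Triple.countableSubsets, ZFSet.mem_sep, ZFSet.mem_powerset]

theorem Triple.countableSubsets_rel {a b : ZFSet.{u}} :
    T.countableSubsets.Rel a b ↔ a ∈ T.countableSubsets.A ∧ b ∈ T.B ∧ ∀ x ∈ a, T.Rel x b := by
  simp only [Triple.Rel, Triple.countableSubsets, ZFSet.mem_sep (p := fun p => ∃ a b, _ ∧ _),
    ZFSet.pair_mem_prod, ZFSet.pair_inj]
  constructor
  · rintro ⟨⟨h1, h2⟩, a', b', ⟨rfl, rfl⟩, h⟩
    exact ⟨h1, h2, h⟩
  · rintro ⟨h1, h2, h⟩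
    exact ⟨⟨h1, h2⟩, a, b, ⟨rfl, rfl⟩, h⟩

theorem countableSubset_mem_H (hA : ∀ x ∈ T.A, x ∈ H κ) {a : ZFSet.{u}}
    (ha : a ∈ T.countableSubsets.A) : a ∈ H κ := by
  obtain ⟨h1, h2⟩ := Triple.mem_countableSubsets_A.1 ha
  exact mem_H_of_countable h2 fun x hx => hA x (h1 hx)

/-- The model $M_{\alpha+1}$ contains $f\restriction\alpha$ and the parameters of
$F\restriction2^\alpha$, hence the countable set $F(f\restriction\alpha)$ and all of its elements.
-/
theorem ElementaryDiamond.phi (hA : ∀ x ∈ T.A, x ∈ H κ)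
    (hE : ElementaryDiamond T prec IsContinuousSeq) :
    T.countableSubsets.Phi (DefinableOrd prec) := by
  let := ordStr prec
  have := memDefinable_ordStr prec
  intro F hF hdef
  have hpar : ∀ α, ∃ P : Finset (H κ), α < ω_ 1 →
      (P : Set (H κ)).Definable₂ ordLang (graphOn κ F (binSeq α)) := by
    intro α
    by_cases hα : α < ω_ 1
    · obtain ⟨P, -, hP⟩ := definable_iff_finitely_definable.1 (hdef α hα)
      exact ⟨P, fun _ => hP⟩
    · exact ⟨∅, fun h => (hα h).elim⟩
  choose P hP using hpar
  let h : Ordinal.{u} → ZFSet.{u} := fun α => ZFSet.range fun a : P α => a.1.1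
  have hhc : ∀ α, (h α : Set ZFSet.{u}).Countable := fun α => by
    simp only [h]
    rw [ZFSet.coe_range]
    exact countable_range _
  obtain ⟨b, hb, hguess⟩ := hE h fun α _ => mem_H_of_countable (hhc α) fun y hy => by
    obtain ⟨a, rfl⟩ := ZFSet.mem_range.1 hy
    exact a.1.2
  refine ⟨b, hb, fun f hf => ?_⟩
  let x : Ordinal.{u} → ZFSet.{u} := restrict f
  have hx : ∀ α < ω_ 1, x α ∈ binSeq α := fun α hα => restrict_mem_binSeq hf hα.le
  obtain ⟨M, hM, -, hmem, hstat⟩ := hguess (tagSeq x)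
    -- The restrictions of `f` do not form a continuous sequence in the sense of the principle, so
    -- they are played in tagged form.
    ⟨fun α hα => tagSeq_mem_H (fun β hβ => mem_H_of_mem_binSeq hβ (hx β hβ)) hα,
      fun α _ hlim => tagSeq_limit x hlim⟩
  refine hstat.mono_limit fun α hα hlim hg => ?_
  have hMα := hM _ (succ_lt_omega_one hα)
  obtain ⟨h1, h2, -⟩ := hMα.of_tripleSet_mem (hmem α hα)
  have hxM : x α ∈ M (α + 1) := by
    refine hMα.mem_of_tagSeq_mem (fun β hβ => mem_H_of_mem_binSeq hβ (hx β hβ))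
      (fun β γ hβγ _ z hz => ?_) (fun β _ hlim z hz => ?_) hα h1
    · obtain ⟨hz, ξ, hξ, y, rfl⟩ := mem_restrict.1 hz
      exact mem_restrict.2 ⟨hz, ξ, hξ.trans_le hβγ, y, rfl⟩
    · obtain ⟨hz, ξ, hξ, y, rfl⟩ := mem_restrict.1 hz
      exact ⟨ξ + 1, hlim.succ_lt hξ, mem_restrict.2 ⟨hz, ξ, Order.lt_add_one_iff.2 le_rfl, y, rfl⟩⟩
  have hFA := hF α hα (x α) (hx α hα)
  have hPM : (P α : Set (H κ)) ⊆ IsCountableElementary.carrier κ (M (α + 1)) := fun a ha =>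
    hMα.subset_of_countable h2 (hhc α) (ZFSet.mem_range.2 ⟨⟨a, ha⟩, rfl⟩)
  have hFM : F (x α) ∈ M (α + 1) := by
    obtain ⟨y, hy, rfl⟩ := hMα.exists_mem (P := fun y => y = F (x α)) (by
      refine DefPred.congr (P := fun w : Option Empty → H κ =>
        x α ∈ binSeq α ∧ (w none).1 = F (x α)) ?_ fun w => by simp [hx α hα]
      refine DefPred.subst (hMα.defTerm_const hxM)
        (P := fun (w : Option Empty → H κ) z => z ∈ binSeq α ∧ (w none).1 = F z) ?_
      exact (((hP α hα).mono hPM).preimage_comp ![none, some none] :))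
      ⟨_, countableSubset_mem_H hA hFA, rfl⟩
    exact hy
  have hsub := hMα.subset_of_countable hFM (Triple.mem_countableSubsets_A.1 hFA).2
  exact Triple.countableSubsets_rel.2 ⟨hFA, hb α hα, fun z hz =>
    hg z ((Triple.mem_countableSubsets_A.1 hFA).1 hz) (hsub hz)⟩

end

/-! ### From the weak diamond to the strategic diamond -/

section
variable {κ : Cardinal.{u}} [UncountableRegular κ] (prec : H κ → H κ → Prop)

/-- The sequence of hulls that starts from the parameters `s` and `h`. -/
noncomputable def hullSeq (h s : Ordinal.{u} → ZFSet.{u}) (ξ : Ordinal.{u}) : ZFSet.{u} :=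
  hull prec {s ξ, h ξ, ZFSet.range fun η : Iio ξ => hullSeq h s η.1}
termination_by ξ
decreasing_by exact η.2

/-- The hull of `⟨s ξ : ξ < α⟩`, `h α` and the sequence of hulls up to `α`. -/
noncomputable def limitHull (h s : Ordinal.{u} → ZFSet.{u}) (α : Ordinal.{u}) : ZFSet.{u} :=
  hull prec {below s (fun _ => True) α, h α, below (hullSeq prec h s) (fun _ => True) α}

theorem hullSeq_eq (h s : Ordinal.{u} → ZFSet.{u}) (ξ : Ordinal.{u}) :
    hullSeq prec h s ξ = hull prec {s ξ, h ξ, below (hullSeq prec h s) (fun _ => True) ξ} := by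
  have : below (hullSeq prec h s) (fun _ => True) ξ =
      ZFSet.range fun η : Iio ξ => hullSeq prec h s η.1 := by
    ext z
    simp [mem_below]
  rw [hullSeq, this]

theorem hullSeq_mem_H (h s : Ordinal.{u} → ZFSet.{u}) (ξ : Ordinal.{u}) :
    hullSeq prec h s ξ ∈ H κ := by
  rw [hullSeq_eq]
  exact hull_mem_H prec _

theorem hullSeq_congr {h s s' : Ordinal.{u} → ZFSet.{u}} {ξ : Ordinal.{u}}
    (e : ∀ η ≤ ξ, s η = s' η) : hullSeq prec h s ξ = hullSeq prec h s' ξ := by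
  induction ξ using WellFoundedLT.induction with
  | ind ξ ih =>
    rw [hullSeq_eq, hullSeq_eq, e ξ le_rfl,
      below_congr fun η hη _ => ih η hη fun ζ hζ => e ζ (hζ.trans hη.le)]

/-- Independence of the values of `s` from `α` on is what allows the hull at a limit to be a
function of a binary sequence of length `α`. -/
theorem limitHull_congr {h s s' : Ordinal.{u} → ZFSet.{u}} {α : Ordinal.{u}}
    (e : ∀ η < α, s η = s' η) : limitHull prec h s α = limitHull prec h s' α := by
  rw [limitHull, limitHull, below_congr fun η hη _ => e η hη,
    below_congr fun η hη _ => hullSeq_congr prec fun ζ hζ => e ζ (hζ.trans_lt hη)]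

/-! ### Binary sequences and their coding of traces -/

theorem mem_binSeq {f : ZFSet.{u}} {α : Ordinal.{u}} : f ∈ binSeq α ↔
    (∀ z ∈ f, ∃ x ∈ α.toZFSet, ∃ y ∈ natSet 2, z = ZFSet.pair x y) ∧
      ∀ x ∈ α.toZFSet, ∃ y ∈ natSet 2, ZFSet.pair x y ∈ f ∧
        ∀ y' ∈ natSet 2, ZFSet.pair x y' ∈ f → y' = y := by
  rw [binSeq, ZFSet.mem_funs]
  constructor
  · rintro ⟨h, h'⟩
    refine ⟨fun z hz => ?_, fun x hx => ?_⟩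
    · obtain ⟨x, hx, y, hy, e⟩ := ZFSet.mem_prod.1 (h hz)
      exact ⟨x, hx, y, hy, e⟩
    · obtain ⟨y, hy, hu⟩ := h' x hx
      exact ⟨y, (ZFSet.pair_mem_prod.1 (h hy)).2, hy, fun y' _ => hu y'⟩
  · rintro ⟨h, h'⟩
    have hsub : f ⊆ ZFSet.prod α.toZFSet (natSet 2) := fun z hz => ZFSet.mem_prod.2 (by
      obtain ⟨x, hx, y, hy, e⟩ := h z hz
      exact ⟨x, hx, y, hy, e⟩)
    refine ⟨hsub, fun x hx => ?_⟩
    obtain ⟨y, -, hy, hu⟩ := h' x hx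
    exact ⟨y, hy, fun y' hy' => hu y' (ZFSet.pair_mem_prod.1 (hsub hy')).2 hy'⟩

theorem eq_of_mem_binSeq {f : ZFSet.{u}} {α β : Ordinal.{u}} (h : f ∈ binSeq α)
    (h' : f ∈ binSeq β) : α = β := by
  have key : ∀ {α β : Ordinal.{u}}, f ∈ binSeq α → f ∈ binSeq β → α.toZFSet ⊆ β.toZFSet := by
    intro α β h h' x hx
    obtain ⟨y, hy, -⟩ := (ZFSet.mem_funs.1 h).2 x hx
    exact (ZFSet.pair_mem_prod.1 ((ZFSet.mem_funs.1 h').1 hy)).1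
  exact le_antisymm (Ordinal.toZFSet_subset_toZFSet_iff.1 (key h h'))
    (Ordinal.toZFSet_subset_toZFSet_iff.1 (key h' h))

theorem natSet_mem_natSet {m n : ℕ} : natSet.{u} m ∈ natSet n ↔ m < n := by
  rw [natSet, natSet, Ordinal.toZFSet_mem_toZFSet_iff]
  exact Nat.cast_lt

/-- The set of ordinals `δ < α` with `f δ = 1`. -/
noncomputable def charSet (α : Ordinal.{u}) (f : ZFSet.{u}) : ZFSet.{u} :=
  α.toZFSet.sep fun δ => ZFSet.pair δ (natSet 1) ∈ f

/-- The characteristic function of `X ∩ α` on `α`. -/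
noncomputable def charFun (X : ZFSet.{u}) (α : Ordinal.{u}) : ZFSet.{u} :=
  open Classical in seqSet (fun δ => if δ.toZFSet ∈ X then natSet 1 else natSet 0) α

theorem charFun_mem_binSeq (X : ZFSet.{u}) (α : Ordinal.{u}) : charFun X α ∈ binSeq α := by
  classical
  have h2 : ∀ δ : Ordinal.{u}, (if δ.toZFSet ∈ X then natSet.{u} 1 else natSet 0) ∈ natSet.{u} 2 := by
    intro δ
    split_ifs <;> exact natSet_mem_natSet.2 (by norm_num)
  refine mem_binSeq.2 ⟨fun z hz => ?_, fun x hx => ?_⟩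
  · rw [charFun, seqSet, mem_below] at hz
    obtain ⟨δ, hδ, -, rfl⟩ := hz
    exact ⟨_, Ordinal.toZFSet_mem_toZFSet_iff.2 hδ, _, h2 δ, rfl⟩
  · obtain ⟨δ, hδ, rfl⟩ := Ordinal.mem_toZFSet_iff.1 hx
    exact ⟨_, h2 δ, pair_mem_seqSet.2 ⟨hδ, rfl⟩, fun y _ hy => (pair_mem_seqSet.1 hy).2⟩

theorem charSet_restrict_charFun (X : ZFSet.{u}) {α β : Ordinal.{u}} (h : α ≤ β) :
    charSet α (restrict (charFun X β) α) = X ∩ α.toZFSet := by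
  classical
  ext z
  rw [charSet, ZFSet.mem_sep, ZFSet.mem_inter, and_comm]
  refine and_congr_left fun hz => ?_
  obtain ⟨δ, hδ, rfl⟩ := Ordinal.mem_toZFSet_iff.1 hz
  have h01 : natSet.{u} 1 ≠ natSet 0 := fun e => one_ne_zero (natSet_injective e)
  rw [mem_restrict, charFun, pair_mem_seqSet]
  constructor
  · rintro ⟨⟨-, h⟩, -⟩
    by_contra hX
    exact h01 (by rwa [if_neg hX] at h)
  · intro hX
    exact ⟨⟨hδ.trans_le h, by rw [if_pos hX]⟩, δ, hδ, _, rfl⟩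

/-- The intersection of `A` with the hull obtained from the sequence coded by `f : α → 2`. -/
noncomputable def codedTrace (π : OrdPairing.{u}) (A : ZFSet.{u}) (h : Ordinal.{u} → ZFSet.{u})
    (α : Ordinal.{u}) (f : ZFSet.{u}) : ZFSet.{u} :=
  A ∩ limitHull prec h (fun ξ => π.decode κ α (charSet α f) ξ.toZFSet) α

/-- Decoding is definable from membership and hulls are definable from $\theta$; the recursion
producing the sequence of hulls has length $\alpha<\omega_1$ and therefore stays definable. The
values of `h` enter through a single parameter, the sequence `seqSet h α`, together with `h α`. -/
theorem defTerm_codedTrace (π : OrdPairing.{u}) {A : ZFSet.{u}} (hA : DefinableSubset κ A)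
    {h : Ordinal.{u} → ZFSet.{u}} {α : Ordinal.{u}} (hα : α < ω_ 1) (hh : ∀ ξ < ω_ 1, h ξ ∈ H κ)
    {ι : Type*} [Finite ι] (i : ι) : letI := truthStr prec
    DefTerm truthLang univ fun v : ι → H κ => codedTrace prec π A h α (v i).1 := by
  let := truthStr prec
  have := memDefinable_truthStr prec
  have hC : ∀ {ι : Type _} [Finite ι] (i : ι),
      DefTerm truthLang univ fun v : ι → H κ => charSet α (v i).1 := by
    intro ι _ i
    refine DefTerm.of_mem_iff (fun _ => mem_H_of_subset (toZFSet_mem_H hα) ZFSet.sep_subset)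
      (fun _ _ _ => ZFSet.mem_sep) (.and (.mem (.var _) (.constU (toZFSet_mem_H hα)))
      (.mem (.pair (.var _) (.constU (natSet_mem_H 1))) (.var _)))
  have hD : ∀ {ι : Type _} [Finite ι] (i j : ι), DefTerm truthLang univ fun v : ι → H κ =>
      π.decode κ α (charSet α (v i).1) (v j).1 := fun i j =>
    π.defTerm_decode hα (mem_univ _) (mem_univ _) (mem_univ _) (hC i) (.var j)
  have hs : DefTerm truthLang univ fun v : ι → H κ =>
      below (fun ξ => π.decode κ α (charSet α (v i).1) ξ.toZFSet) (fun _ => True) α :=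
    .below_of_rec hα (mem_univ _)
      (g := fun v x _ => π.decode κ α (charSet α (v i).1) x) (hD _ _) fun _ _ _ => rfl
  have hM : DefTerm truthLang univ fun v : ι → H κ => below (hullSeq prec h fun ξ =>
      π.decode κ α (charSet α (v i).1) ξ.toZFSet) (fun _ => True) α := by
    refine .below_of_rec hα (mem_univ _) (g := fun v x y => hull prec
      {π.decode κ α (charSet α (v i).1) x, relApp (seqSet h α) x, y}) ?_ fun v ξ hξ => ?_
    · exact defTerm_hull prec (fun _ => mem_univ _) (.tripleSet (hD _ _)
        (.relApp (.constU (seqSet_mem_H hα fun β hβ => hh β (hβ.trans hα))) (.var _)) (.var _))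
    · rw [relApp_seqSet hξ]
      exact hullSeq_eq prec _ _ _
  have hL : DefTerm truthLang univ fun v : ι → H κ =>
      limitHull prec h (fun ξ => π.decode κ α (charSet α (v i).1) ξ.toZFSet) α :=
    defTerm_hull prec (fun _ => mem_univ _) (.tripleSet hs (.constU (hh α hα)) hM)
  exact DefTerm.of_mem_iff (fun v => mem_H_of_subset (hL.1 v) fun _ hz => (ZFSet.mem_inter.1 hz).2)
    (fun _ _ _ => ZFSet.mem_inter)
    (.and (definableSubset_truth prec hA none) (.mem (.var _) (hL.reindex some)))

theorem defPred_mem_binSeq {α : Ordinal.{u}} (hα : α < ω_ 1) {L : FirstOrder.Language.{0, 0}}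
    [L.Structure (H κ)] [MemDefinable κ L] {ι : Type*} [Finite ι] (i : ι) :
    DefPred L univ fun v : ι → H κ => (v i).1 ∈ binSeq α := by
  have hαt : ∀ {ι : Type _} [Finite ι], DefTerm L univ fun _ : ι → H κ => α.toZFSet :=
    fun {_} _ => .constU (toZFSet_mem_H hα)
  have h2 : ∀ {ι : Type _} [Finite ι], DefTerm L univ fun _ : ι → H κ => natSet.{u} 2 :=
    fun {_} _ => .constU (natSet_mem_H 2)
  refine DefPred.congr ?_ fun _ => mem_binSeq
  exact .and (.allMem (.var _) (.exMem hαt (.exMem h2 (.eq (.var _) (.pair (.var _) (.var _))))))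
    (.allMem hαt (.exMem h2 (.and (.mem (.pair (.var _) (.var _)) (.var _))
      (.allMem h2 (.imp (.mem (.pair (.var _) (.var _)) (.var _)) (.eq (.var _) (.var _)))))))

theorem two_mul_add_one_div_two (ξ : Ordinal.{u}) : (2 * ξ + 1) / 2 = ξ := by
  rw [Ordinal.mul_add_div _ two_ne_zero, Ordinal.div_eq_zero_of_lt one_lt_two, add_zero]

theorem isCountableElementary_hullSeq [IsWellOrder _ prec] {h s : Ordinal.{u} → ZFSet.{u}}
    {ξ : Ordinal.{u}} (hξ : ξ < ω_ 1) (hs : s ξ ∈ H κ) (hh : h ξ ∈ H κ) :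
    IsCountableElementary prec (hullSeq prec h s ξ) ∧
      ({s ξ, h ξ, below (hullSeq prec h s) (fun _ => True) ξ} : ZFSet.{u}) ∈
        hullSeq prec h s ξ := by
  have : ({s ξ, h ξ, below (hullSeq prec h s) (fun _ => True) ξ} : ZFSet.{u}) ∈ H κ :=
    tripleSet_mem_H hs hh (below_mem_H hξ fun _ _ _ => hullSeq_mem_H prec _ _ _)
  rw [hullSeq_eq prec h s ξ]
  exact ⟨isCountableElementary_hull prec this, self_mem_hull prec this⟩

variable {T : Triple.{u}}

/-- `F` predicts, from a code for BAD's moves before a limit `α`, the trace on `A` of GOOD's answer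
at `α + 1`. The function `g` given by the weak diamond for `F` is used as the sequence of guesses.
-/
theorem strategicDiamond_of_phi [IsWellOrder _ prec] (hA : DefinableSubset κ T.A)
    (hPhi : T.countableSubsets.Phi (DefinableTruth prec)) : StrategicDiamond T prec := by
  classical
  let := truthStr prec
  have := memDefinable_truthStr prec
  intro h hh
  obtain ⟨π⟩ := OrdPairing.nonempty.{u}
  let h' : Ordinal.{u} → ZFSet.{u} := fun ξ => h (2 * ξ)
  have hh' : ∀ ξ < ω_ 1, h' ξ ∈ H κ := fun ξ hξ => hh _ (two_mul_lt_omega_one hξ)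
  -- The domain of `f` determines `α`, so the functions on the individual levels combine into one
  -- `F`.
  let F : ZFSet.{u} → ZFSet.{u} := fun f =>
    if hf : ∃ α < ω_ 1, f ∈ binSeq α then codedTrace prec π T.A h' hf.choose f else ∅
  have hF : ∀ α < ω_ 1, ∀ f ∈ binSeq α, F f = codedTrace prec π T.A h' α f := by
    intro α hα f hf
    have hex : ∃ α < ω_ 1, f ∈ binSeq α := ⟨α, hα, hf⟩
    simp only [F, dif_pos hex]
    rw [eq_of_mem_binSeq hex.choose_spec.2 hf]
  obtain ⟨g, hg, hstat⟩ := hPhi F (fun α hα f hf => by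
    rw [hF α hα f hf]
    refine Triple.mem_countableSubsets_A.2 ⟨fun z hz => (ZFSet.mem_inter.1 hz).1, ?_⟩
    exact (countable_hull prec _).mono fun z hz => (ZFSet.mem_inter.1 hz).2) fun α hα => by
    have : DefPred truthLang univ fun v : Fin 2 → H κ =>
        (v 0).1 ∈ binSeq α ∧ (v 1).1 = codedTrace prec π T.A h' α (v 0).1 :=
      .and (defPred_mem_binSeq hα 0) (.eq (.var 1) (defTerm_codedTrace prec π hA hα hh' 0))
    refine this.congr fun v => and_congr_right fun hv => ?_
    rw [← hF α hα _ hv]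
  let σ : Ordinal.{u} → (Ordinal.{u} → ZFSet.{u}) → ZFSet.{u} := fun β t =>
    if IsOdd β then hullSeq prec h' (fun ξ => t (2 * ξ)) (β / 2) else ∅
  have hσ : ∀ ξ t, σ (2 * ξ + 1) t = hullSeq prec h' (fun ξ => t (2 * ξ)) ξ := fun ξ t => by
    have : IsOdd (2 * ξ + 1) := ⟨ξ, rfl⟩
    simp only [σ, if_pos this, two_mul_add_one_div_two]
  refine ⟨g, hg, σ, fun β t t' htt => ?_, fun t ht => ⟨?_, ?_⟩⟩
  · by_cases hβ : IsOdd β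
    · obtain ⟨ξ, rfl⟩ := hβ
      rw [hσ, hσ]
      refine hullSeq_congr prec fun η hη => htt _ (Order.lt_add_one_iff.2 ?_) ⟨η, rfl⟩
      gcongr
    · simp only [σ, if_neg hβ]
  · rintro _ hα ⟨ξ, rfl⟩
    have hξ : ξ < ω_ 1 := (Ordinal.le_mul_right ξ two_pos).trans_lt hα
    beta_reduce
    rw [below_isOdd_two_mul]
    simp only [hσ]
    exact isCountableElementary_hullSeq prec hξ (H_aleph_one_subset κ (ht.1 _ hα ⟨ξ, rfl⟩)) (hh' ξ hξ)
  · let s : Ordinal.{u} → ZFSet.{u} := fun ξ => t (2 * ξ)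
    obtain ⟨X, -, hX⟩ := π.exists_code (s := s) fun ξ hξ => ht.1 _ (two_mul_lt_omega_one hξ) ⟨ξ, rfl⟩
    obtain ⟨C, hC, hCα⟩ := π.exists_isClub (fun _ => ∅) (fun _ _ => countable_empty)
      fun _ _ _ h => h.elim
    -- The weak diamond is applied to the characteristic function of the code `X` of this run of
    -- BAD. Its guesses count on the club of `α` where `X ∩ α` decodes the moves before `α`.
    have hf := charFun_mem_binSeq X (ω_ 1)
    refine (hstat _ hf).mono hC fun α hα hrel => ?_
    have hcl := (hCα α hα).1
    have hlim := hcl.isSuccLimit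
    have h2 := two_mul_limit hlim
    refine ⟨⟨α, h2.symm⟩, ?_⟩
    have hM : σ (α.1 + 1) t = limitHull prec h' s α := by
      have := hσ α.1 t
      rw [h2] at this
      -- The limit rule forces BAD's move at `α` to be the set of earlier moves, so GOOD's answer is
      -- the hull that `F` computes.
      rw [this, hullSeq_eq, h2, ht.2 _ hcl.lt hlim, below_isEven_limit t hlim]
      rfl
    rw [mem_ofPred_eq, hF _ hcl.lt _ (restrict_mem_binSeq hf hcl.lt.le), codedTrace,
      charSet_restrict_charFun X hcl.lt.le,
      limitHull_congr prec fun ξ hξ => hX κ α hcl ξ hξ] at hrel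
    intro a ha haM
    beta_reduce at haM
    rw [hM] at haM
    exact (Triple.countableSubsets_rel.1 hrel).2.2 a (ZFSet.mem_inter.2 ⟨ha, haM⟩)

end

/-! ### From traces to continuous sequences -/

/-- The least index of a model that contains `s β`, `h β` and the set of models chosen before. -/
noncomputable def leastIdx (M s h : Ordinal.{u} → ZFSet.{u}) (β : Ordinal.{u}) : Ordinal.{u} :=
  sInf {δ | δ < ω_ 1 ∧
    ({s β, h β, ZFSet.range fun γ : Iio β => M (leastIdx M s h γ.1)} : ZFSet.{u}) ∈ M δ}
termination_by β
decreasing_by exact γ.2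

/-- The first model that contains `s β`, `h β` and the set of models chosen before. -/
noncomputable def leastModel (M s h : Ordinal.{u} → ZFSet.{u}) (β : Ordinal.{u}) : ZFSet.{u} :=
  M (leastIdx M s h β)

/-- The set that the model chosen at `β` must contain. -/
noncomputable def leastTask (M s h : Ordinal.{u} → ZFSet.{u}) (β : Ordinal.{u}) : ZFSet.{u} :=
  {s β, h β, below (leastModel M s h) (fun _ => True) β}

theorem leastIdx_eq (M s h : Ordinal.{u} → ZFSet.{u}) (β : Ordinal.{u}) :
    leastIdx M s h β = sInf {δ | δ < ω_ 1 ∧ leastTask M s h β ∈ M δ} := by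
  have : below (leastModel M s h) (fun _ => True) β =
      ZFSet.range fun γ : Iio β => M (leastIdx M s h γ.1) := by
    ext z
    simp [mem_below, leastModel]
  rw [leastIdx, leastTask, this]

theorem leastIdx_le {M s h : Ordinal.{u} → ZFSet.{u}} {β δ : Ordinal.{u}} (hδ : δ < ω_ 1)
    (hm : leastTask M s h β ∈ M δ) : leastIdx M s h β ≤ δ := by
  rw [leastIdx_eq]
  exact csInf_le' ⟨hδ, hm⟩

theorem leastIdx_spec {M s h : Ordinal.{u} → ZFSet.{u}} {β δ : Ordinal.{u}} (hδ : δ < ω_ 1)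
    (hm : leastTask M s h β ∈ M δ) :
    leastIdx M s h β < ω_ 1 ∧ leastTask M s h β ∈ leastModel M s h β := by
  rw [leastModel, leastIdx_eq]
  exact csInf_mem (s := {δ | δ < ω_ 1 ∧ leastTask M s h β ∈ M δ}) ⟨δ, hδ, hm⟩

section
variable {κ : Cardinal.{u}} [UncountableRegular κ] {prec : H κ → H κ → Prop}

/-- The decoding is carried out inside `N`, from the code `X ∩ δ` and the pairing on `δ`. The
sequence `h` is given up to `δ + 1` so that `h δ` is included. -/
theorem sequence_mem {π : OrdPairing.{u}} {N X : ZFSet.{u}} {s h : Ordinal.{u} → ZFSet.{u}}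
    {δ : Ordinal.{u}} (hδ : π.IsClosed δ) (hN : IsCountableElementary prec N)
    (hX : ∀ β < δ, π.decode κ δ (X ∩ δ.toZFSet) β.toZFSet = s β)
    (hXN : X ∩ δ.toZFSet ∈ N) (hhN : seqSet h (δ + 1) ∈ N) (hπN : π.graph δ ∈ N)
    (hδN : δ.toZFSet ∈ N) :
    (∀ β < δ, s β ∈ N) ∧ (∀ β ≤ δ, h β ∈ N) ∧ below s (fun _ => True) δ ∈ N := by
  let := ordStr prec
  have := memDefinable_ordStr prec
  have h0N : ∅ ∈ N := by
    have := hN.natSet_mem 0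
    rwa [natSet, Nat.cast_zero, Ordinal.toZFSet_zero] at this
  have hord : ∀ β ≤ δ, β.toZFSet ∈ N := fun β hβ => by
    rcases hβ.eq_or_lt with rfl | hβ
    · exact hδN
    · exact hN.subset_of_countable hδN (countable_toZFSet hδ.lt)
        (Ordinal.toZFSet_mem_toZFSet_iff.2 hβ)
  refine ⟨fun β hβ => ?_, fun β hβ => ?_, ?_⟩
  · rw [← hX β hβ]
    exact hN.mem_of_defTerm (π.defTerm_decode hδ.lt hδN h0N hπN (hN.defTerm_const hXN)
      (hN.defTerm_const (hord β hβ.le)))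
  · rw [← relApp_seqSet (f := h) (Order.lt_add_one_iff.2 hβ)]
    exact hN.mem_of_defTerm (.relApp (hN.defTerm_const hhN) (hN.defTerm_const (hord β hβ)))
  · refine hN.mem_of_defTerm (.below_of_rec (w := fun _ => s) hδ.lt hδN
      (g := fun _ x _ => π.decode κ δ (X ∩ δ.toZFSet) x) ?_ fun _ ξ hξ => (hX ξ hξ).symm)
    exact π.defTerm_decode hδ.lt hδN h0N hπN (hN.defTerm_const hXN) (.var _)

/-- The recursion that chooses the models can be repeated inside `N`. Since the earlier choices have
indices below `δ`, the set of models `M η`, `η < δ`, suffices as a parameter, without their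
indexing. -/
theorem below_leastModel_mem {π : OrdPairing.{u}} {N X : ZFSet.{u}}
    {M s h : Ordinal.{u} → ZFSet.{u}} {β δ : Ordinal.{u}} (hδ : π.IsClosed δ)
    (hN : IsCountableElementary prec N)
    (hX : ∀ β < δ, π.decode κ δ (X ∩ δ.toZFSet) β.toZFSet = s β)
    (hXN : X ∩ δ.toZFSet ∈ N) (hhN : seqSet h (δ + 1) ∈ N) (hπN : π.graph δ ∈ N)
    (hδN : δ.toZFSet ∈ N) (hMN : below M (fun _ => True) δ ∈ N)
    (hmono : ∀ α β : Ordinal.{u}, α ≤ β → β < ω_ 1 → M α ⊆ M β) (hβ : β ≤ δ)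
    (hidx : ∀ γ < β, leastIdx M s h γ < δ ∧ leastTask M s h γ ∈ leastModel M s h γ) :
    below (leastModel M s h) (fun _ => True) β ∈ N := by
  let := ordStr prec
  have := memDefinable_ordStr prec
  have h0N : ∅ ∈ N := by
    have := hN.natSet_mem 0
    rwa [natSet, Nat.cast_zero, Ordinal.toZFSet_zero] at this
  have hβN : β.toZFSet ∈ N := by
    rcases hβ.eq_or_lt with rfl | hβ
    · exact hδN
    · exact hN.subset_of_countable hδN (countable_toZFSet hδ.lt)
        (Ordinal.toZFSet_mem_toZFSet_iff.2 hβ)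
  let 𝓜 := below M (fun _ => True) δ
  let τ : ZFSet.{u} → ZFSet.{u} → ZFSet.{u} := fun ξ x =>
    {π.decode κ δ (X ∩ δ.toZFSet) ξ, relApp (seqSet h (δ + 1)) ξ, x}
  -- As the chain is increasing, the first model containing the task is the intersection of all
  -- models in `𝓜` that contain it. The first conjunct keeps this intersection inside the union of
  -- `𝓜`.
  let Q : ZFSet.{u} → ZFSet.{u} → ZFSet.{u} → Prop := fun ξ x u =>
    (∃ K ∈ 𝓜, τ ξ x ∈ K ∧ u ∈ K) ∧ ∀ K ∈ 𝓜, τ ξ x ∈ K → u ∈ K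
  have hQ : ∀ ξ x u, u ∈ (ZFSet.sUnion 𝓜).sep (Q ξ x) ↔ Q ξ x u := by
    intro ξ x u
    rw [ZFSet.mem_sep, and_iff_right_iff_imp]
    rintro ⟨⟨K, hK, -, hu⟩, -⟩
    exact ZFSet.mem_sUnion.2 ⟨K, hK, hu⟩
  refine hN.mem_of_defTerm (.below_of_rec (w := fun _ => leastModel M s h) (hβ.trans_lt hδ.lt) hβN
    (g := fun _ ξ x => (ZFSet.sUnion 𝓜).sep (Q ξ x)) ?_ fun _ ξ hξ => ?_)
  · refine DefTerm.of_mem_iff (fun _ => mem_H_of_subset (sUnion_mem_H (hN.subset_H hMN))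
      ZFSet.sep_subset) (fun _ u _ => hQ _ _ u) ?_
    have hτ : ∀ {ι : Type _} [Finite ι] (i j : ι),
        DefTerm ordLang (IsCountableElementary.carrier κ N) fun v : ι → H κ =>
          τ (v i).1 (v j).1 := fun i j =>
      .tripleSet (π.defTerm_decode hδ.lt hδN h0N hπN (hN.defTerm_const hXN) (.var i))
        (.relApp (hN.defTerm_const hhN) (.var i)) (.var j)
    exact .and (.exMem (hN.defTerm_const hMN) (.and (.mem (hτ _ _) (.var _))
      (.mem (.var _) (.var _)))) (.allMem (hN.defTerm_const hMN) (.imp (.mem (hτ _ _) (.var _))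
      (.mem (.var _) (.var _))))
  · have hξδ := hξ.trans_le hβ
    have hτ : τ ξ.toZFSet (below (leastModel M s h) (fun _ => True) ξ) = leastTask M s h ξ := by
      simp only [τ]
      rw [hX ξ hξδ, relApp_seqSet (hξδ.trans (Order.lt_add_one_iff.2 le_rfl)), leastTask]
    obtain ⟨h1, h2⟩ := hidx ξ hξ
    ext u
    rw [hQ]
    simp only [Q, hτ]
    constructor
    · refine fun hu => ⟨⟨_, mem_below.2 ⟨_, h1, trivial, rfl⟩, h2, hu⟩, fun K hK hK' => ?_⟩
      obtain ⟨η, hη, -, rfl⟩ := mem_below.1 hK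
      exact hmono _ _ (leastIdx_le (hη.trans hδ.lt) hK') (hη.trans hδ.lt) hu
    · exact fun hu => hu.2 _ (mem_below.2 ⟨_, h1, trivial, rfl⟩) h2

variable {T : Triple.{u}}

/-- The trace diamond is applied to a code `X` of `s`, with the tools for decoding and the given `h`
packed into the parameters. The resulting chain is replaced by the first models that perform the
tasks for `s`. -/
theorem ElementaryDiamond.of_isTraceSeq (hT : ElementaryDiamond T prec IsTraceSeq) :
    ElementaryDiamond T prec IsContinuousSeq := by
  intro h hh
  obtain ⟨π⟩ := OrdPairing.nonempty.{u}
  obtain ⟨b, hb, hguess⟩ := hT (fun α => {seqSet h (α + 1), π.graph α, α.toZFSet}) fun α hα =>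
    tripleSet_mem_H (seqSet_mem_H (succ_lt_omega_one hα) fun β hβ =>
      hh β (hβ.trans (succ_lt_omega_one hα))) (π.graph_mem_H hα) (toZFSet_mem_H hα)
  refine ⟨b, hb, fun s hs => ?_⟩
  obtain ⟨X, hXω, hX⟩ := π.exists_code hs.1
  obtain ⟨M, hM, hmono, hmem, hstat⟩ := hguess (fun α => X ∩ α.toZFSet)
    ⟨X, hXω, fun _ _ => rfl⟩
  have hparam : ∀ δ, π.IsClosed δ → X ∩ δ.toZFSet ∈ M (δ + 1) ∧ seqSet h (δ + 1) ∈ M (δ + 1) ∧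
      π.graph δ ∈ M (δ + 1) ∧ δ.toZFSet ∈ M (δ + 1) ∧ below M (fun _ => True) δ ∈ M (δ + 1) := by
    intro δ hδ
    have hN := hM _ (succ_lt_omega_one hδ.lt)
    obtain ⟨h1, h2, h3⟩ := hN.of_tripleSet_mem (hmem δ hδ.lt)
    obtain ⟨h4, h5, h6⟩ := hN.of_tripleSet_mem h2
    exact ⟨h1, h4, h5, h6, h3⟩
  have hseq := fun (δ) (hδ : π.IsClosed δ) =>
    have ⟨h1, h2, h3, h4, _⟩ := hparam δ hδ
    sequence_mem hδ (hM _ (succ_lt_omega_one hδ.lt)) (hX κ δ hδ) h1 h2 h3 h4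
  have hbelow : ∀ δ, π.IsClosed δ → ∀ β ≤ δ, (∀ γ < β, leastIdx M s h γ < δ ∧
      leastTask M s h γ ∈ leastModel M s h γ) →
      below (leastModel M s h) (fun _ => True) β ∈ M (δ + 1) := by
    intro δ hδ β hβ hidx
    obtain ⟨h1, h2, h3, h4, h5⟩ := hparam δ hδ
    exact below_leastModel_mem hδ (hM _ (succ_lt_omega_one hδ.lt)) (hX κ δ hδ) h1 h2 h3 h4 h5
      hmono hβ hidx
  have hidx : ∀ β < ω_ 1, leastIdx M s h β < ω_ 1 ∧
      leastTask M s h β ∈ leastModel M s h β := by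
    intro β hβ
    induction β using WellFoundedLT.induction with
    | ind β ih =>
      -- Any closed `δ` above `β` and above all earlier indices works: `M (δ + 1)` contains the task
      -- at `β`, so the least index is not a default value.
      obtain ⟨a, ha, hle⟩ := exists_bound (S := leastIdx M s h '' Iio β)
        ((countable_Iio hβ).image _) (by
          rintro _ ⟨γ, hγ, rfl⟩
          exact (ih γ hγ (lt_trans hγ hβ)).1)
      obtain ⟨C, hC, hCα⟩ := π.exists_isClub (fun _ => ∅) (fun _ _ => countable_empty)
        fun _ _ _ h => h.elim
      obtain ⟨⟨δ, hδω⟩, hδC, hδ⟩ := hC.2 ⟨max a β + 1, succ_lt_omega_one (max_lt ha hβ)⟩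
      have hδ : max a β < δ := Order.add_one_le_iff.1 hδ
      have hcl := (hCα _ hδC).1
      have hδ' := succ_lt_omega_one hδω
      have hβδ := (le_max_right a β).trans_lt hδ
      obtain ⟨h1, h2, -⟩ := hseq δ hcl
      exact leastIdx_spec hδ' ((hM _ hδ').tripleSet_mem (h1 β hβδ) (h2 β hβδ.le)
        (hbelow δ hcl β hβδ.le fun γ hγ =>
          ⟨(hle _ ⟨γ, hγ, rfl⟩).trans_lt ((le_max_left a β).trans_lt hδ),
            (ih γ hγ (hγ.trans hβ)).2⟩))
  refine exists_chain (N := leastModel M s h) (fun α hα => hM _ (hidx α hα).1)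
    (fun α hα => (hidx α hα).2) ?_
  obtain ⟨C, hC, hCα⟩ := π.exists_isClub (fun δ => {leastIdx M s h δ})
    (fun _ _ => countable_singleton _) fun δ hδ ε hε => by
      rw [mem_singleton_iff.1 hε]
      exact (hidx δ hδ).1
  refine hstat.mono hC fun α hα hg => ?_
  obtain ⟨hcl, hcl'⟩ := hCα α hα
  obtain ⟨-, h2, h3⟩ := hseq α hcl
  have hα' := succ_lt_omega_one hcl.lt
  -- Only the values of `s` below `α` can be decoded from `X ∩ α`; continuity gives `s α` itself.
  -- Hence the task at `α` lies in `M (α + 1)`, the model chosen at `α` is contained in it, and the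
  -- guess for `M (α + 1)` applies.
  rw [← hs.2 α hcl.lt hcl.isSuccLimit] at h3
  have hle := leastIdx_le hα' ((hM _ hα').tripleSet_mem h3 (h2 α le_rfl)
    (hbelow α hcl α le_rfl fun γ hγ => ⟨hcl' γ hγ _ rfl, (hidx γ (hγ.trans hcl.lt)).2⟩))
  exact fun a ha haM => hg a ha (hmono _ _ hle hα' haM)

end

end GuessingModels

theorem mainTheorem3 (κ : Cardinal.{u}) (hκ : κ.IsRegular) (hκ' : ℵ₀ < κ)
    (prec : GuessingModels.H κ → GuessingModels.H κ → Prop) (hprec : IsWellOrder _ prec)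
    (T : GuessingModels.Triple.{u}) (hT : T.IsInvariant) (hTdef : T.IsDefinable κ) :
    (T.countableSubsets.Phi (GuessingModels.DefinableTruth prec) →
      GuessingModels.StrategicDiamond T prec) ∧
    (GuessingModels.StrategicDiamond T prec →
      GuessingModels.ElementaryDiamond T prec GuessingModels.IsTraceSeq) ∧
    (GuessingModels.ElementaryDiamond T prec GuessingModels.IsTraceSeq →
      GuessingModels.ElementaryDiamond T prec GuessingModels.IsContinuousSeq) ∧
    (GuessingModels.ElementaryDiamond T prec GuessingModels.IsContinuousSeq →
      T.countableSubsets.Phi (GuessingModels.DefinableOrd prec)) := by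
  have : GuessingModels.UncountableRegular κ := ⟨hκ, hκ'⟩
  exact ⟨GuessingModels.strategicDiamond_of_phi prec hTdef.1,
    GuessingModels.StrategicDiamond.elementaryDiamond,
    GuessingModels.ElementaryDiamond.of_isTraceSeq,
    GuessingModels.ElementaryDiamond.phi hTdef.1.1⟩
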